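/- Let $(X,Y),(X_1,Y_1),(X_2,Y_2),\dots$ be independent, identically distributed pairs of real random variables whose law has a density $g(s,t)$ on $\mathbb{R}^2$. Let $f(x)=\int_{\mathbb{R}} g(x,t)\,dt$ be the density of $X$ and, where $f(x)\neq 0$, let $r(x)=\mathbb{E}(Y\mid X=x)=\frac{1}{f(x)}\int_{\mathbb{R}} t\,g(x,t)\,dt$. For $c\in\mathbb{R}$, write $(v_n)_{n\ge1}\in\mathcal{GS}(c)$ if $(v_n)$ is a nonrandom positive sequence with $\lim_{n\to\infty} n\,[1-v_{n-1}/v_n]=c$. Given a kernel $K$, stepsizes $(\gamma_n)$, bandwidths $(h_n)$ and a nonrandom initial function $r_0$, the generalized Révész estimator is defined for $n\ge 1$ by $$r_n(x)=r_{n-1}(x)+\gamma_n\Big[h_n^{-1}Y_nK\big(h_n^{-1}(x-X_n)\big)-h_n^{-1}K\big(h_n^{-1}(x-X_n)\big)\,r_{n-1}(x)\Big].$$ Let $I$ be a nonempty bounded open interval of $\mathbb{R}$ with $\varphi=\inf_{x\in I}f(x)>0$, let $r_0$ be bounded on $I$, and assume the following. (A1) $K:\mathbb{R}\to\mathbb{R}$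 is nonnegative, continuous and bounded, with $\int K(z)\,dz=1$, $\int zK(z)\,dz=0$ and $\int z^2K(z)\,dz<\infty$. (A2) $(\gamma_n)\in\mathcal{GS}(-\alpha)$ with $\alpha\in(3/4,1]$, and $\lim_{n\to\infty}(n\gamma_n)^{-1}$ exists and is finite; $(h_n)\in\mathcal{GS}(-a)$ with $a\in\left(\frac{1-\alpha}{4},\frac{\alpha}{3}\right)$. (A3) i) For every $t$, $s\mapsto g(s,t)$ is twice continuously differentiable on $\mathbb{R}$. ii) For $q\in\{0,1,2\}$, $s\mapsto\int t^q g(s,t)\,dt$ is well defined and bounded on $\mathbb{R}$, and continuous at every point of $I$; for every real $q\in[2,3]$, $s\mapsto\int|t|^q g(s,t)\,dt$ is bounded on $\mathbb{R}$. iii) For $q\in\{0,1\}$: $\int|t|^q\left|\frac{\partial g}{\partial s}(x,t)\right|dt<\infty$ for every $x\in I$; $s\mapsto\int t^q\frac{\partial^2 g}{\partial s^2}(s,t)\,dt$ is well defined (as an absolutely convergent integral) and bounded on $\mathbb{R}$, and continuous at every point of $I$; and $\int_{-M}^{M}\int_{\mathbb{R}}|t|^q\left|\frac{\partial^2 g}{\partial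 s^2}(s,t)\right|dt\,ds<\infty$ for every $M>0$. (A4) i) $K$ is Lipschitz continuous. ii) There is $t^*>0$ with $\mathbb{E}\left(\exp(t^*|Y|)\right)<\infty$. iii) $a\in\left(1-\alpha,\alpha-\frac23\right)$. iv) For $q\in\{0,1\}$, $x\mapsto\int|t|^q\left|\frac{\partial g}{\partial s}(x,t)\right|dt$ is (finite and) bounded on $\{x: f(x)>0\}$. Then: 1. If the sequence $\left(\gamma_n^{-1}h_n^5/(\ln n)^2\right)_{n\ge2}$ is bounded and $\lim_{n\to\infty}n\gamma_n>(1-a)/(2\varphi)$ (the limit may be $+\infty$), then $$\sup_{x\in I}|r_n(x)-r(x)|=O\left(\sqrt{\gamma_nh_n^{-1}}\,\ln n\right)\quad\text{almost surely.}$$ 2. If $\lim_{n\to\infty}\gamma_n^{-1}h_n^5/(\ln n)^2=\infty$ and $\lim_{n\to\infty}n\gamma_n>2a/\varphi$ (the limit may be $+\infty$), then $$\sup_{x\in I}|r_n(x)-r(x)|=O\left(h_n^2\right)\quad\text{almost surely.}$$ -/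

import Mathlib

open MeasureTheory ProbabilityTheory Filter Topology Asymptotics

noncomputable section

/-- The class `GS(c)` of sequences `(v n)`, `n ≥ 1`: positive, with `n (1 - v (n-1) / v n) → c`.
The value `v 0` plays no role. -/
def GS (v : ℕ → ℝ) (c : ℝ) : Prop :=
  (∀ n : ℕ, 1 ≤ n → 0 < v n) ∧
    Tendsto (fun n : ℕ => (n : ℝ) * (1 - v (n - 1) / v n)) atTop (𝓝 c)

/-- The density `f x = ∫ g(x,t) dt` of `X`, when `g` is the density of `(X,Y)`. -/
def marginalDensity (g : ℝ → ℝ → ℝ) (x : ℝ) : ℝ := ∫ t, g x t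

/-- The regression function `r x = E(Y | X = x)` of a pair `(X,Y)` with density `g`. -/
def regressionFunction (g : ℝ → ℝ → ℝ) (x : ℝ) : ℝ :=
  (∫ t, t * g x t) / marginalDensity g x

/-- The partial derivative `∂g/∂s (s,t)`. -/
def partialS (g : ℝ → ℝ → ℝ) (s t : ℝ) : ℝ := deriv (fun u => g u t) s

/-- The second partial derivative `∂²g/∂s² (s,t)`. -/
def partialSS (g : ℝ → ℝ → ℝ) (s t : ℝ) : ℝ := iteratedDeriv 2 (fun u => g u t) s

/-- The pairs `(X n, Y n)`, `n ∈ ℕ`, are independent and have the same law, with density `g` on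
`ℝ²`. The pair of index `0` is the generic pair `(X,Y)`; the sample starts at index `1`. -/
structure IsIIDSample {Ω : Type*} [MeasurableSpace Ω] (μ : Measure Ω) (X Y : ℕ → Ω → ℝ)
    (g : ℝ → ℝ → ℝ) : Prop where
  measurable_X : ∀ n, Measurable (X n)
  measurable_Y : ∀ n, Measurable (Y n)
  measurable_g : Measurable (fun p : ℝ × ℝ => g p.1 p.2)
  nonneg_g : ∀ s t, 0 ≤ g s t
  indep : iIndepFun (fun n ω => (X n ω, Y n ω)) μ
  law : ∀ n, μ.map (fun ω => (X n ω, Y n ω)) =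
    (volume : Measure (ℝ × ℝ)).withDensity (fun p => ENNReal.ofReal (g p.1 p.2))

/-- The generalized Révész estimator `r_n(x)`, with stepsizes `γ`, bandwidths `h`, kernel `K`,
initial function `r₀`:
`r_n(x) = r_{n-1}(x) + γ_n 𝒲_n(x)`, with
`𝒲_n(x) = h_n⁻¹ Y_n K(h_n⁻¹ (x - X_n)) - h_n⁻¹ K(h_n⁻¹ (x - X_n)) r_{n-1}(x)`. -/
def revesz {Ω : Type*} (γ h : ℕ → ℝ) (K : ℝ → ℝ) (X Y : ℕ → Ω → ℝ) (r₀ : ℝ → ℝ) :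
    ℕ → ℝ → Ω → ℝ
  | 0, x, _ => r₀ x
  | n + 1, x, ω =>
      revesz γ h K X Y r₀ n x ω + γ (n + 1) *
        ((h (n + 1))⁻¹ * Y (n + 1) ω * K ((h (n + 1))⁻¹ * (x - X (n + 1) ω))
          - (h (n + 1))⁻¹ * K ((h (n + 1))⁻¹ * (x - X (n + 1) ω)) *
              revesz γ h K X Y r₀ n x ω)

/-- Assumption (A1) on the kernel. -/
structure AssumptionA1 (K : ℝ → ℝ) : Prop where
  nonneg : ∀ z, 0 ≤ K z
  continuous : Continuous K
  bounded : ∃ C, ∀ z, K z ≤ C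
  integral_eq_one : ∫ z, K z = 1
  integral_mul_eq_zero : ∫ z, z * K z = 0
  integrable_sq_mul : Integrable (fun z => z ^ 2 * K z)

/-- Assumption (A2) on the stepsizes and the bandwidths. -/
structure AssumptionA2 (γ h : ℕ → ℝ) (α a : ℝ) : Prop where
  alpha_mem : α ∈ Set.Ioc (3 / 4 : ℝ) 1
  stepsize : GS γ (-α)
  limit_exists : ∃ ξ : ℝ, Tendsto (fun n : ℕ => ((n : ℝ) * γ n)⁻¹) atTop (𝓝 ξ)
  a_mem : a ∈ Set.Ioo ((1 - α) / 4) (α / 3)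
  bandwidth : GS h (-a)

/-- Assumption (A3) on the density `g` of `(X,Y)`, at the point `x`. -/
structure AssumptionA3 (g : ℝ → ℝ → ℝ) (x : ℝ) : Prop where
  contDiff : ∀ t, ContDiff ℝ 2 (fun s => g s t)
  moment_integrable : ∀ q : ℕ, q ≤ 2 → ∀ s, Integrable (fun t => t ^ q * g s t)
  moment_bounded : ∀ q : ℕ, q ≤ 2 → ∃ C, ∀ s, |∫ t, t ^ q * g s t| ≤ C
  moment_continuousAt : ∀ q : ℕ, q ≤ 2 → ContinuousAt (fun s => ∫ t, t ^ q * g s t) x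
  absMoment_integrable : ∀ q ∈ Set.Icc (2 : ℝ) 3, ∀ s, Integrable (fun t => |t| ^ q * g s t)
  absMoment_bounded : ∀ q ∈ Set.Icc (2 : ℝ) 3, ∃ C, ∀ s, ∫ t, |t| ^ q * g s t ≤ C
  partialS_integrable : ∀ q : ℕ, q ≤ 1 → Integrable (fun t => |t| ^ q * |partialS g x t|)
  partialSS_integrable : ∀ q : ℕ, q ≤ 1 → ∀ s, Integrable (fun t => t ^ q * partialSS g s t)
  /-- Integrability on the bounded strips: integration in `t` and in `s` may be exchanged. -/
  partialSS_integrableOn : ∀ q : ℕ, q ≤ 1 → ∀ M : ℝ,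
    IntegrableOn (fun p : ℝ × ℝ => p.2 ^ q * partialSS g p.1 p.2) (Set.Icc (-M) M ×ˢ Set.univ)
  partialSS_bounded : ∀ q : ℕ, q ≤ 1 → ∃ C, ∀ s, |∫ t, t ^ q * partialSS g s t| ≤ C
  partialSS_continuousAt : ∀ q : ℕ, q ≤ 1 →
    ContinuousAt (fun s => ∫ t, t ^ q * partialSS g s t) x

/-- Assumption (A4), with `Y` the generic response variable. -/
structure AssumptionA4 {Ω : Type*} [MeasurableSpace Ω] (μ : Measure Ω) (Y : Ω → ℝ) (K : ℝ → ℝ)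
    (g : ℝ → ℝ → ℝ) (α a : ℝ) : Prop where
  lipschitz : ∃ L, LipschitzWith L K
  exp_moment : ∃ t : ℝ, 0 < t ∧ Integrable (fun ω => Real.exp (t * |Y ω|)) μ
  a_mem : a ∈ Set.Ioo (1 - α) (α - 2 / 3)
  partialS_bounded : ∀ q : ℕ, q ≤ 1 → ∃ C, ∀ x, 0 < marginalDensity g x →
    Integrable (fun t => |t| ^ q * |partialS g x t|) ∧ ∫ t, |t| ^ q * |partialS g x t| ≤ C

/-- `lim_{n → ∞} n γ_n` exists in `[-∞, ∞]` and is `> c`. -/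
def LimStepGT (γ : ℕ → ℝ) (c : ℝ) : Prop :=
  ∃ L : EReal, Tendsto (fun n : ℕ => (((n : ℝ) * γ n : ℝ) : EReal)) atTop (𝓝 L) ∧ (c : EReal) < L

/-- `sup_{x ∈ I} |F_n x| = O(v_n)`; the suprema are required to be finite. -/
def SupBigO (I : Set ℝ) (F : ℕ → ℝ → ℝ) (v : ℕ → ℝ) : Prop :=
  (∀ n, BddAbove ((fun x => |F n x|) '' I)) ∧
    (fun n => sSup ((fun x => |F n x|) '' I)) =O[atTop] v

end

/-! Put `θ = r(x)` and `Z = h_n⁻¹ K(h_n⁻¹(x - X_n))`. The error `ρ = r_{n-1}(x) - θ` becomes `ρ(1 -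
γ_n Z) + γ_n Z (Y_n - θ)`. Since `E Z = f(x) + O(h_n²)` with `f ≥ φ` on the interval, the mean
dynamics contract at rate about `γ_n φ`. The centred input has mean `O(γ_n h_n²)` and variance
`O(γ_n² / h_n)`.

Both rates come from one argument, run with a normalisation `lam n` such that `lam n * h_n²` is
`O(ln n)` (bias) and `lam n² * γ_n / h_n` is `O(1)` (noise). The target is an error `O(ln n / lam
n)`. Part 1 takes `lam = (γ/h)^(-1/2)` and part 2 takes `lam = ln n / h²`. The condition on `lim n
γ_n` says that `lam` grows more slowly than the recursion contracts (`eventually_contraction`).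

The Lyapunov functional is `E exp(lam n |r_n(x) - r(x)|)`, restricted to the event that every
`|Y_k|` stays below `M + (8/t) ln k`. One step with the past frozen (`exp_error_step`) adds to the
exponent a negative multiple of `lam n |ρ|` and an `O(γ_n ln n)` term. Either `lam (n-1) |ρ|`
exceeds a multiple of `ln n` and the contraction absorbs the new terms, or the exponential is
already polynomial in `n` (`exp_contraction_dichotomy`). Hence the functional grows at most
polynomially (`lyapunov_polynomial`).

Markov's inequality at level `n^a`, a union bound over `n^7` grid points and Borel-Cantelli give
`lam n |error| ≤ a ln n` on the grid (`ae_grid_rate`). The estimator has Lipschitz constant `O(n⁴)`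
in `x`, so the mesh of order `n⁻⁷` carries the rate to the whole interval (`ae_uniform_rate`). The
exponential moment puts almost every path below the envelope for some natural `M`.

The initial function is merely bounded, so the Lipschitz argument is applied to the constants `0`
and `1`. As `r_n(x)` is affine in `r₀(x)`, these two cases give the general one (`ae_supBigO`). -/

noncomputable section

/-! ### Moments of the density and bias of kernel smoothing -/

/-- The moment functions `s ↦ ∫ t^q g(s,t) dt`. -/
def momentFun (g : ℝ → ℝ → ℝ) (q : ℕ) (s : ℝ) : ℝ := ∫ t, t ^ q * g s t

lemma taylor_two_integral {G : ℝ → ℝ} (hG : ContDiff ℝ 2 G) (x s : ℝ) :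
    G s - G x - (s - x) * deriv G x = ∫ u in x..s, (s - u) * iteratedDeriv 2 G u := by
  have h1 : ContDiff ℝ 1 (deriv G) := hG.iterate_deriv' 1 1
  have h2 : ∀ u, HasDerivAt (deriv G) (iteratedDeriv 2 G u) u := by
    intro u
    have := ((h1.differentiable one_ne_zero) u).hasDerivAt
    rwa [iteratedDeriv_succ, iteratedDeriv_one]
  have hc : Continuous (iteratedDeriv 2 G) := hG.continuous_iteratedDeriv 2 (by norm_num)
  have h0 : ∀ u, HasDerivAt G (deriv G u) u := fun u =>
    ((hG.differentiable two_ne_zero) u).hasDerivAt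
  have key : ∀ u ∈ Set.uIcc x s,
      HasDerivAt (fun u => (s - u) * deriv G u + G u) ((s - u) * iteratedDeriv 2 G u) u := by
    intro u _
    have hs : HasDerivAt (fun u => s - u) (-1) u := by
      simpa using (hasDerivAt_id u).const_sub s
    exact ((hs.mul (h2 u)).add (h0 u)).congr_deriv (by ring)
  rw [intervalIntegral.integral_eq_sub_of_hasDerivAt key
    (Continuous.intervalIntegrable (by fun_prop) _ _)]
  ring

/-- Taylor's formula with integral remainder is integrated in `t`, and Fubini on a bounded strip
exchanges the integrals. Only the signed integral of the second derivative then has to be bounded,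
uniformly in `s`, which makes the constant independent of `x`. -/
lemma moment_expansion {g : ℝ → ℝ → ℝ} {q : ℕ} (hc : ∀ t, ContDiff ℝ 2 (fun s => g s t))
    (hint : ∀ s, Integrable (fun t => t ^ q * g s t))
    (hon : ∀ M : ℝ, IntegrableOn (fun p : ℝ × ℝ => p.2 ^ q * partialSS g p.1 p.2)
      (Set.Icc (-M) M ×ˢ Set.univ))
    {C : ℝ} (hC : ∀ s, |∫ t, t ^ q * partialSS g s t| ≤ C) (x s : ℝ) :
    |momentFun g q s - momentFun g q x - (s - x) * ∫ t, t ^ q * partialS g x t|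
      ≤ C * (s - x) ^ 2 := by
  have hC0 : 0 ≤ C := (abs_nonneg _).trans (hC 0)
  have hprod : ∀ s : ℝ, Integrable (Function.uncurry fun u t => (s - u) * (t ^ q * partialSS g u t))
      ((volume.restrict (Set.uIoc x s)).prod volume) := by
    intro s
    have hsub : Set.uIoc x s ⊆ Set.Icc (-(|x| + |s|)) (|x| + |s|) := by
      intro u hu
      have h1 := abs_nonneg x; have h2 := abs_nonneg s
      have h3 := neg_abs_le x; have h4 := neg_abs_le s
      have h5 := le_abs_self x; have h6 := le_abs_self s
      rcases Set.mem_uIoc.1 hu with h | h <;> constructor <;> linarith [h.1, h.2]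
    have h1 : Integrable (fun p : ℝ × ℝ => p.2 ^ q * partialSS g p.1 p.2)
        ((volume.restrict (Set.uIoc x s)).prod volume) := by
      have := (hon (|x| + |s|)).mono_set (Set.prod_mono hsub (subset_refl Set.univ))
      rwa [IntegrableOn, Measure.volume_eq_prod, ← Measure.prod_restrict,
        Measure.restrict_univ] at this
    have hmem : ∀ᵐ p : ℝ × ℝ ∂((volume.restrict (Set.uIoc x s)).prod volume),
        p.1 ∈ Set.uIoc x s := by
      have : ∀ᵐ u ∂(volume.restrict (Set.uIoc x s)), u ∈ Set.uIoc x s :=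
        ae_restrict_mem measurableSet_uIoc
      exact Measure.quasiMeasurePreserving_fst.ae this
    refine h1.bdd_mul (f := fun p : ℝ × ℝ => s - p.1) (c := |s| + (|x| + |s|))
      (by fun_prop) ?_
    filter_upwards [hmem] with p hp
    have h2 := hsub hp
    rw [Real.norm_eq_abs]
    have : |p.1| ≤ |x| + |s| := abs_le.2 ⟨h2.1, h2.2⟩
    exact (abs_sub _ _).trans (by linarith)
  have hpt : ∀ s t, t ^ q * g s t - t ^ q * g x t - (s - x) * (t ^ q * partialS g x t)
      = ∫ u in x..s, (s - u) * (t ^ q * partialSS g u t) := by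
    intro s t
    have := taylor_two_integral (hc t) x s
    calc _ = t ^ q * (g s t - g x t - (s - x) * deriv (fun u => g u t) x) := by
            rw [partialS]; ring
      _ = t ^ q * ∫ u in x..s, (s - u) * partialSS g u t := by rw [this]; rfl
      _ = _ := by
        rw [← intervalIntegral.integral_const_mul]
        congr 1; ext u; ring
  have hRint : ∀ s, Integrable (fun t => ∫ u in x..s, (s - u) * (t ^ q * partialSS g u t)) := by
    intro s
    have := (hprod s).integral_prod_right
    simp only [Function.uncurry] at this
    rcases le_total x s with h | h
    · simp_rw [intervalIntegral.integral_of_le h]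
      rwa [Set.uIoc_of_le h] at this
    · simp_rw [intervalIntegral.integral_of_ge h]
      rw [Set.uIoc_of_ge h] at this
      exact this.neg
  -- At `s = x + 1` the factor `s - x` is `1`, so Taylor's formula writes the first-derivative term
  -- as a combination of integrable functions.
  have hdint : Integrable (fun t => t ^ q * partialS g x t) := by
    have := ((hint (x + 1)).sub (hint x)).sub (hRint (x + 1))
    refine this.congr (Eventually.of_forall fun t => ?_)
    have := hpt (x + 1) t
    simp only [Pi.sub_apply]
    rw [← this]; ring
  have heq : momentFun g q s - momentFun g q x - (s - x) * ∫ t, t ^ q * partialS g x t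
      = ∫ u in x..s, (s - u) * ∫ t, t ^ q * partialSS g u t := by
    have hsw := intervalIntegral_integral_swap (hprod s)
    simp_rw [← integral_const_mul]
    simp only [← hpt] at hsw
    rw [hsw, integral_sub _ (hdint.const_mul _), integral_sub (hint s) (hint x)]
    · rfl
    · exact (hint s).sub (hint x)
  rw [heq, ← Real.norm_eq_abs]
  have hb := intervalIntegral.norm_integral_le_of_norm_le_const (a := x) (b := s)
    (f := fun u => (s - u) * ∫ t, t ^ q * partialSS g u t) (C := |s - x| * C) (by
      intro u hu
      rw [norm_mul]
      refine mul_le_mul ?_ (hC u) (norm_nonneg _) (abs_nonneg _)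
      rw [Real.norm_eq_abs]
      rcases Set.mem_uIoc.1 hu with h | h
      · rw [abs_of_nonneg (by linarith [h.2]), abs_of_nonneg (by linarith [h.1, h.2])]; linarith [h.1]
      · rw [abs_of_nonpos (by linarith [h.1]), abs_of_nonpos (by linarith [h.1, h.2])]; linarith [h.2])
  refine hb.trans (le_of_eq ?_)
  rw [← sq_abs (s - x)]; ring

/-- A nonintegrable function has integral `0` by convention, so total integral `1` forces
integrability. -/
lemma AssumptionA1.integrable {K : ℝ → ℝ} (hK : AssumptionA1 K) : Integrable K := by
  by_contra h
  have := hK.integral_eq_one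
  rw [integral_undef h] at this
  exact zero_ne_one this

/-- A kernel smoother reproduces, up to `O(h²)`, a bounded function with a quadratic expansion. -/
lemma kernel_smoothing_bias {K : ℝ → ℝ} (hK : AssumptionA1 K) {m : ℝ → ℝ} {x d C B : ℝ}
    (hm : Measurable m) (hB : ∀ s, |m s| ≤ B)
    (hexp : ∀ s, |m s - m x - (s - x) * d| ≤ C * (s - x) ^ 2) {η : ℝ} (hη : 0 < η) :
    |(∫ s, η⁻¹ * K (η⁻¹ * (x - s)) * m s) - m x| ≤ C * (∫ z, z ^ 2 * K z) * η ^ 2 := by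
  have hKi := hK.integrable
  have hzK : Integrable (fun z => z * K z) := by
    refine (hKi.add hK.integrable_sq_mul).mono' ?_ (Eventually.of_forall fun z => ?_)
    · exact (continuous_id.mul hK.continuous).aestronglyMeasurable
    · rw [norm_mul, Real.norm_eq_abs, Real.norm_eq_abs, abs_of_nonneg (hK.nonneg z)]
      simp only [Pi.add_apply]
      nlinarith [hK.nonneg z, abs_nonneg z, sq_abs z, sq_nonneg (|z| - 1)]
  have hcv : (∫ s, η⁻¹ * K (η⁻¹ * (x - s)) * m s) = ∫ z, K z * m (x - η * z) := by
    have h1 := integral_sub_left_eq_self (fun w => η⁻¹ * K (η⁻¹ * w) * m (x - w)) volume x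
    simp only [sub_sub_cancel] at h1
    rw [h1]
    have h2 := Measure.integral_comp_inv_mul_left (fun z => K z * m (x - η * z)) η
    simp only [mul_inv_cancel_left₀ hη.ne', abs_of_pos hη, smul_eq_mul] at h2
    simp_rw [mul_assoc]
    rw [integral_const_mul, h2, inv_mul_cancel_left₀ hη.ne']
  have hmi : Integrable (fun z => K z * m (x - η * z)) := by
    refine hKi.mul_bdd (c := B) ?_ (Eventually.of_forall fun z => hB _)
    exact (hm.comp (by fun_prop)).aestronglyMeasurable
  -- `∫ K = 1` allows `m x` to be subtracted under the integral, and `∫ z K = 0` allows the linear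
  -- term to be subtracted too; only the quadratic remainder is left.
  have heq : (∫ s, η⁻¹ * K (η⁻¹ * (x - s)) * m s) - m x
      = ∫ z, K z * (m (x - η * z) - m x - ((x - η * z) - x) * d) := by
    have h3 : ∀ z, K z * (m (x - η * z) - m x - ((x - η * z) - x) * d)
        = K z * m (x - η * z) - K z * m x + (η * d) * (z * K z) := fun z => by ring
    simp_rw [h3]
    have h5 : Integrable (fun z => K z * m (x - η * z) - K z * m x) :=
      hmi.sub (hKi.mul_const _)
    rw [integral_add h5 (hzK.const_mul _), integral_sub hmi (hKi.mul_const _), integral_mul_const, integral_const_mul,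
      hK.integral_eq_one, hK.integral_mul_eq_zero, hcv]
    ring
  rw [heq, ← Real.norm_eq_abs]
  have h4 : C * (∫ z, z ^ 2 * K z) * η ^ 2 = ∫ z, (C * η ^ 2) * (z ^ 2 * K z) := by
    rw [integral_const_mul]; ring
  rw [h4]
  refine norm_integral_le_of_norm_le (hK.integrable_sq_mul.const_mul _)
    (Eventually.of_forall fun z => ?_)
  rw [norm_mul, Real.norm_eq_abs, Real.norm_eq_abs, abs_of_nonneg (hK.nonneg z)]
  have := hexp (x - η * z)
  calc _ ≤ K z * (C * ((x - η * z) - x) ^ 2) := mul_le_mul_of_nonneg_left this (hK.nonneg z)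
    _ = _ := by ring

/-! ### Kernel statistics under the law of the sample -/

/-- The rescaled kernel `η⁻¹ K(η⁻¹ (x - s))`. -/
def scaledKernel (K : ℝ → ℝ) (η x s : ℝ) : ℝ := η⁻¹ * K (η⁻¹ * (x - s))

/-- The law on `ℝ²` with density `g`. -/
def densityLaw (g : ℝ → ℝ → ℝ) : Measure (ℝ × ℝ) :=
  (volume : Measure (ℝ × ℝ)).withDensity (fun p => ENNReal.ofReal (g p.1 p.2))

lemma scaledKernel_nonneg {K : ℝ → ℝ} (hK : ∀ z, 0 ≤ K z) {η : ℝ} (hη : 0 < η) (x s : ℝ) :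
    0 ≤ scaledKernel K η x s := mul_nonneg (inv_nonneg.2 hη.le) (hK _)

lemma scaledKernel_le {K : ℝ → ℝ} {Q : ℝ} (hK : ∀ z, K z ≤ Q) {η : ℝ} (hη : 0 < η) (x s : ℝ) :
    scaledKernel K η x s ≤ η⁻¹ * Q := mul_le_mul_of_nonneg_left (hK _) (inv_nonneg.2 hη.le)

lemma continuous_scaledKernel {K : ℝ → ℝ} (hK : Continuous K) (η x : ℝ) :
    Continuous (scaledKernel K η x) := by
  unfold scaledKernel
  fun_prop

lemma scaledKernel_integrable {K : ℝ → ℝ} (hK : AssumptionA1 K) {η : ℝ} (hη : 0 < η) (x : ℝ) :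
    Integrable (scaledKernel K η x) := by
  have h1 : Integrable (fun w => K (η⁻¹ * w)) := hK.integrable.comp_mul_left' (inv_ne_zero hη.ne')
  exact (h1.comp_sub_left x).const_mul _

lemma scaledKernel_integral {K : ℝ → ℝ} (hK : AssumptionA1 K) {η : ℝ} (hη : 0 < η) (x : ℝ) :
    ∫ s, scaledKernel K η x s = 1 := by
  unfold scaledKernel
  rw [integral_const_mul, integral_sub_left_eq_self (fun w => K (η⁻¹ * w)) volume x,
    Measure.integral_comp_inv_mul_left, hK.integral_eq_one, abs_of_pos hη, smul_eq_mul, mul_one,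
    inv_mul_cancel₀ hη.ne']

section Law

variable {g : ℝ → ℝ → ℝ} {K : ℝ → ℝ}

lemma measurable_momentFun (hg : Measurable (fun p : ℝ × ℝ => g p.1 p.2)) (q : ℕ) :
    Measurable (momentFun g q) := by
  have : StronglyMeasurable (Function.uncurry fun s t => t ^ q * g s t) :=
    (Measurable.mul (by fun_prop) hg).stronglyMeasurable
  exact this.integral_prod_right.measurable

/-- Fubini needs absolute moments, whereas the bounds concern signed ones. For `q ≤ 2` the
inequality `|t|^q ≤ 1 + t²` reduces everything to the even moments `0` and `2`. -/
lemma law_integral (hg : Measurable (fun p : ℝ × ℝ => g p.1 p.2)) (hg0 : ∀ s t, 0 ≤ g s t)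
    (hK : AssumptionA1 K)
    (hint : ∀ q : ℕ, q ≤ 2 → ∀ s, Integrable (fun t => t ^ q * g s t))
    (hbd : ∀ q : ℕ, q ≤ 2 → ∃ C, ∀ s, |∫ t, t ^ q * g s t| ≤ C)
    {q : ℕ} (hq : q ≤ 2) {η : ℝ} (hη : 0 < η) (x : ℝ) :
    Integrable (fun p : ℝ × ℝ => scaledKernel K η x p.1 * p.2 ^ q) (densityLaw g) ∧
      ∫ p, scaledKernel K η x p.1 * p.2 ^ q ∂(densityLaw g)
        = ∫ s, scaledKernel K η x s * momentFun g q s := by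
  have hden : Measurable (fun p : ℝ × ℝ => ENNReal.ofReal (g p.1 p.2)) := hg.ennreal_ofReal
  have hfin : ∀ᵐ p : ℝ × ℝ, ENNReal.ofReal (g p.1 p.2) < ⊤ :=
    Eventually.of_forall fun _ => ENNReal.ofReal_lt_top
  obtain ⟨B0, hB0⟩ := hbd 0 (by norm_num)
  obtain ⟨B2, hB2⟩ := hbd 2 le_rfl
  have hkc := continuous_scaledKernel hK.continuous η x
  have hmeas : Measurable (fun p : ℝ × ℝ => g p.1 p.2 * (scaledKernel K η x p.1 * p.2 ^ q)) :=
    hg.mul ((hkc.measurable.comp measurable_fst).mul (by fun_prop))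
  have habs : ∀ t : ℝ, |t| ^ q ≤ 1 + t ^ 2 := by
    intro t
    have h1 := abs_nonneg t
    have h2 := sq_abs t
    interval_cases q
    · simp; positivity
    · nlinarith [sq_nonneg (|t| - 1)]
    · rw [sq_abs]; linarith
  have hk0 : ∀ s, 0 ≤ scaledKernel K η x s := scaledKernel_nonneg hK.nonneg hη x
  have hI : Integrable (fun p : ℝ × ℝ => g p.1 p.2 * (scaledKernel K η x p.1 * p.2 ^ q))
      (volume.prod volume) := by
    rw [integrable_prod_iff hmeas.aestronglyMeasurable]
    constructor
    · refine Eventually.of_forall fun s => ?_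
      refine ((hint q hq s).const_mul (scaledKernel K η x s)).congr
        (Eventually.of_forall fun t => ?_)
      ring
    · refine ((scaledKernel_integrable hK hη x).mul_const (B0 + B2)).mono'
        (hmeas.aestronglyMeasurable.norm.integral_prod_right') (Eventually.of_forall fun s => ?_)
      rw [Real.norm_eq_abs, abs_of_nonneg (integral_nonneg fun t => norm_nonneg _)]
      have h0 := hint 0 (by norm_num) s
      have h2 := hint 2 le_rfl s
      calc ∫ t, ‖g s t * (scaledKernel K η x s * t ^ q)‖
          ≤ ∫ t, scaledKernel K η x s * (t ^ 0 * g s t + t ^ 2 * g s t) := by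
            refine integral_mono_of_nonneg (Eventually.of_forall fun t => norm_nonneg _)
              ((h0.add h2).const_mul _) (Eventually.of_forall fun t => ?_)
            simp only [norm_mul, norm_pow, Real.norm_eq_abs]
            rw [abs_of_nonneg (hg0 s t), abs_of_nonneg (hk0 s)]
            calc g s t * (scaledKernel K η x s * |t| ^ q)
                = (scaledKernel K η x s * g s t) * |t| ^ q := by ring
              _ ≤ (scaledKernel K η x s * g s t) * (1 + t ^ 2) :=
                mul_le_mul_of_nonneg_left (habs t) (mul_nonneg (hk0 s) (hg0 s t))
              _ = _ := by ring
        _ = scaledKernel K η x s * ((∫ t, t ^ 0 * g s t) + ∫ t, t ^ 2 * g s t) := by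
            rw [integral_const_mul, integral_add h0 h2]
        _ ≤ _ := mul_le_mul_of_nonneg_left
            (add_le_add ((le_abs_self _).trans (hB0 s)) ((le_abs_self _).trans (hB2 s))) (hk0 s)
  have hto : ∀ p : ℝ × ℝ, (ENNReal.ofReal (g p.1 p.2)).toReal • (scaledKernel K η x p.1 * p.2 ^ q)
      = g p.1 p.2 * (scaledKernel K η x p.1 * p.2 ^ q) := fun p => by
    rw [ENNReal.toReal_ofReal (hg0 _ _), smul_eq_mul]
  constructor
  · rw [densityLaw, integrable_withDensity_iff_integrable_smul' hden hfin]
    simp_rw [hto]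
    exact hI
  · rw [densityLaw, integral_withDensity_eq_integral_toReal_smul hden hfin]
    simp_rw [hto]
    rw [Measure.volume_eq_prod, integral_prod _ hI]
    congr 1; ext s
    rw [momentFun, ← integral_const_mul]
    congr 1; ext t; ring

/-- Bias and second moment bounds for the kernel statistics, uniform over a set. -/
lemma kernel_moment_bounds (hg : Measurable (fun p : ℝ × ℝ => g p.1 p.2))
    (hg0 : ∀ s t, 0 ≤ g s t) (hK : AssumptionA1 K) {I : Set ℝ} (hne : I.Nonempty)
    (hA3 : ∀ x ∈ I, AssumptionA3 g x) :
    ∃ C, 0 ≤ C ∧ (∀ x ∈ I, ∀ η : ℝ, 0 < η →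
      (∀ q : ℕ, q ≤ 2 →
        Integrable (fun p : ℝ × ℝ => scaledKernel K η x p.1 * p.2 ^ q) (densityLaw g) ∧
        ∫ p, scaledKernel K η x p.1 * p.2 ^ q ∂(densityLaw g) ≤ C) ∧
      (∀ q : ℕ, q ≤ 1 →
        |∫ p, scaledKernel K η x p.1 * p.2 ^ q ∂(densityLaw g) - momentFun g q x| ≤ C * η ^ 2)) ∧
      (∀ q : ℕ, q ≤ 1 → ∀ x, |momentFun g q x| ≤ C) ∧
      (∀ q : ℕ, q ≤ 1 → ∀ x ∈ I, ∀ y ∈ I, |y - x| ≤ 1 →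
        |momentFun g q y - momentFun g q x| ≤ C * |y - x|) := by
  obtain ⟨x0, hx0⟩ := hne
  -- The assertions used below concern all `s`, not only the base point, so a single `x0` supplies
  -- constants uniform over the set.
  have h3 := hA3 x0 hx0
  choose! B hB using h3.moment_bounded
  choose! D hD using h3.partialSS_bounded
  set S := ∫ z, z ^ 2 * K z with hS
  have hS0 : 0 ≤ S := integral_nonneg fun z => mul_nonneg (sq_nonneg z) (hK.nonneg z)
  have hB0 : ∀ q, q ≤ 2 → 0 ≤ B q := fun q hq => (abs_nonneg _).trans (hB q hq 0)
  have hD0 : ∀ q, q ≤ 1 → 0 ≤ D q := fun q hq => (abs_nonneg _).trans (hD q hq 0)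
  have b0 := hB0 0 (by norm_num)
  have b1 := hB0 1 (by norm_num)
  have b2 := hB0 2 (by norm_num)
  have d0 := hD0 0 (by norm_num)
  have d1 := hD0 1 (by norm_num)
  have hexp : ∀ q, q ≤ 1 → ∀ x s, |momentFun g q s - momentFun g q x
      - (s - x) * ∫ t, t ^ q * partialS g x t| ≤ D q * (s - x) ^ 2 := fun q hq x s =>
    moment_expansion h3.contDiff (h3.moment_integrable q (by omega))
      (h3.partialSS_integrableOn q hq) (hD q hq) x s
  have hmB : ∀ q, q ≤ 2 → ∀ s, |momentFun g q s| ≤ B q := fun q hq s => hB q hq s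
  have hBs : ∀ q, q ≤ 2 → B q ≤ B 0 + B 1 + B 2 := by
    intro q hq; interval_cases q <;> linarith
  have hDs : ∀ q, q ≤ 1 → D q ≤ D 0 + D 1 := by
    intro q hq; interval_cases q <;> linarith
  set Bs := B 0 + B 1 + B 2
  set Ds := D 0 + D 1
  have hBs0 : 0 ≤ Bs := by positivity
  have hDs0 : 0 ≤ Ds := by positivity
  refine ⟨2 * Bs + 2 * Ds + Ds * S, by positivity, ?_, ?_, ?_⟩
  · intro x _ η hη
    have hDS : 0 ≤ Ds * S := by positivity
    constructor
    · intro q hq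
      obtain ⟨h1, h2⟩ := law_integral hg hg0 hK h3.moment_integrable h3.moment_bounded hq hη x
      refine ⟨h1, ?_⟩
      rw [h2]
      have h4 : ∫ s, scaledKernel K η x s * momentFun g q s ≤ ∫ s, scaledKernel K η x s * B q := by
        refine integral_mono
          ((scaledKernel_integrable hK hη x).mul_bdd (c := B q)
            (measurable_momentFun hg q).aestronglyMeasurable
            (Eventually.of_forall fun s => hmB q hq s))
          ((scaledKernel_integrable hK hη x).mul_const _) fun s => ?_
        exact mul_le_mul_of_nonneg_left ((le_abs_self _).trans (hmB q hq s))
          (scaledKernel_nonneg hK.nonneg hη x s)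
      rw [integral_mul_const, scaledKernel_integral hK hη, one_mul] at h4
      linarith [hBs q hq]
    · intro q hq
      obtain ⟨h1, h2⟩ := law_integral hg hg0 hK h3.moment_integrable h3.moment_bounded
        (show q ≤ 2 by omega) hη x
      rw [h2]
      refine (kernel_smoothing_bias hK (measurable_momentFun hg q) (hmB q (by omega))
        (hexp q hq x) hη).trans ?_
      refine mul_le_mul_of_nonneg_right ?_ (sq_nonneg η)
      have := mul_le_mul_of_nonneg_right (hDs q hq) hS0
      linarith
  · intro q hq x
    have hDS : 0 ≤ Ds * S := by positivity
    linarith [hmB q (by omega) x, hBs q (by omega)]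
  · intro q hq x _ y _ hxy
    have hDS : 0 ≤ Ds * S := by positivity
    set d := ∫ t, t ^ q * partialS g x t
    -- The derivative is controlled by the expansion over a unit increment, since the moment
    -- function itself is bounded.
    have hd : |d| ≤ 2 * Bs + Ds := by
      have h4 := hexp q hq x (x + 1)
      have h5 := hmB q (by omega) x
      have h6 := hmB q (by omega) (x + 1)
      have h7 := hBs q (by omega)
      have h8 := hDs q hq
      have e1 : x + 1 - x = 1 := by ring
      rw [e1, one_mul, one_pow, mul_one] at h4
      rw [abs_le] at h4 h5 h6 ⊢
      constructor <;> linarith [h4.1, h4.2, h5.1, h5.2, h6.1, h6.2]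
    have h9 := hexp q hq x y
    have h10 : |momentFun g q y - momentFun g q x| ≤ |(y - x) * d| + D q * (y - x) ^ 2 := by
      have := abs_add_le (momentFun g q y - momentFun g q x - (y - x) * d) ((y - x) * d)
      rw [sub_add_cancel] at this
      linarith
    rw [abs_mul, ← sq_abs (y - x)] at h10
    have h11 := abs_nonneg (y - x)
    have h12 : |y - x| ^ 2 ≤ |y - x| := by nlinarith
    have h13 := mul_le_mul (hDs q hq) h12 (sq_nonneg _) hDs0
    have h14 := mul_le_mul_of_nonneg_left hd h11
    nlinarith [mul_nonneg h11 hDS]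

end Law

/-! ### Regularity of the regression function and tails of the response -/

/-- Bounds and Lipschitz continuity of the regression function where the density is bounded below. -/
lemma regressionFunction_bounds {g : ℝ → ℝ → ℝ} {I : Set ℝ} {C φ : ℝ} (hφ : 0 < φ) (hC : 0 ≤ C)
    (hf : ∀ x ∈ I, φ ≤ marginalDensity g x)
    (hb : ∀ q : ℕ, q ≤ 1 → ∀ x, |momentFun g q x| ≤ C)
    (hl : ∀ q : ℕ, q ≤ 1 → ∀ x ∈ I, ∀ y ∈ I, |y - x| ≤ 1 →
      |momentFun g q y - momentFun g q x| ≤ C * |y - x|) :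
    ∃ R, 0 ≤ R ∧ (∀ x ∈ I, |regressionFunction g x| ≤ R) ∧
      ∀ x ∈ I, ∀ y ∈ I, |y - x| ≤ 1 →
        |regressionFunction g y - regressionFunction g x| ≤ R * |y - x| := by
  have hm0 : ∀ x, momentFun g 0 x = marginalDensity g x := fun x => by
    simp [momentFun, marginalDensity]
  have hr : ∀ x, regressionFunction g x = momentFun g 1 x / marginalDensity g x := fun x => by
    simp [momentFun, regressionFunction]
  have hrb : ∀ x ∈ I, |regressionFunction g x| ≤ C / φ := by
    intro x hx
    rw [hr, abs_div, abs_of_pos (hφ.trans_le (hf x hx))]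
    exact div_le_div₀ hC (hb 1 le_rfl x) hφ (hf x hx)
  have hCφ : 0 ≤ C / φ := by positivity
  have hCφ2 : 0 ≤ (C + C / φ * C) / φ := by positivity
  refine ⟨C / φ + (C + C / φ * C) / φ, by positivity, fun x hx => (hrb x hx).trans (by linarith),
    fun x hx y hy hxy => ?_⟩
  have hfx := hφ.trans_le (hf x hx)
  have hfy := hφ.trans_le (hf y hy)
  have e : regressionFunction g y - regressionFunction g x =
      ((momentFun g 1 y - momentFun g 1 x) - regressionFunction g x *
        (momentFun g 0 y - momentFun g 0 x)) / marginalDensity g y := by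
    rw [hm0, hm0, hr, hr]
    field_simp
    ring
  rw [e, abs_div, abs_of_pos hfy]
  have h1 := hl 1 le_rfl x hx y hy hxy
  have h0 := hl 0 (by norm_num) x hx y hy hxy
  have h2 : |momentFun g 1 y - momentFun g 1 x - regressionFunction g x *
        (momentFun g 0 y - momentFun g 0 x)| ≤ C * |y - x| + C / φ * (C * |y - x|) := by
    refine (abs_sub _ _).trans (add_le_add h1 ?_)
    rw [abs_mul]
    exact mul_le_mul (hrb x hx) h0 (abs_nonneg _) hCφ
  refine (div_le_div₀ (by positivity) h2 hφ (hf y hy)).trans ?_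
  have : (C * |y - x| + C / φ * (C * |y - x|)) / φ = (C + C / φ * C) / φ * |y - x| := by ring
  rw [this]
  exact mul_le_mul_of_nonneg_right (by linarith) (abs_nonneg _)

/-- Exponential tail of the first absolute moment. -/
lemma exp_tail_bound {ν : Measure (ℝ × ℝ)} {t : ℝ} (ht : 0 < t)
    (hexp : Integrable (fun p : ℝ × ℝ => Real.exp (t * |p.2|)) ν) :
    ∃ C, 0 ≤ C ∧ ∀ τ : ℝ,
      Integrable ({p : ℝ × ℝ | τ < |p.2|}.indicator fun p => 1 + |p.2|) ν ∧
      ∫ p, {p : ℝ × ℝ | τ < |p.2|}.indicator (fun p => 1 + |p.2|) p ∂ν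
        ≤ C * Real.exp (-(t / 2) * τ) := by
  set E := ∫ p, Real.exp (t * |p.2|) ∂ν
  have hE : 0 ≤ E := integral_nonneg fun p => (Real.exp_pos _).le
  have hpt : ∀ (τ : ℝ) (p : ℝ × ℝ), {p : ℝ × ℝ | τ < |p.2|}.indicator (fun p => 1 + |p.2|) p ≤
      (1 + 2 / t) * Real.exp (-(t / 2) * τ) * Real.exp (t * |p.2|) := by
    intro τ p
    by_cases hp : τ < |p.2|
    · rw [Set.indicator_of_mem (by exact hp)]
      -- Half of the exponential moment absorbs the factor `1 + |y|`; the other half yields the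
      -- decay in `τ`.
      have h1 : 1 + |p.2| ≤ (1 + 2 / t) * Real.exp ((t / 2) * |p.2|) := by
        have h2 := Real.add_one_le_exp ((t / 2) * |p.2|)
        have h3 : 0 ≤ t / 2 * |p.2| := by positivity
        have h4 : 1 ≤ Real.exp ((t / 2) * |p.2|) := Real.one_le_exp h3
        have h5 : |p.2| = 2 / t * (t / 2 * |p.2|) := by field_simp
        have h6 : 2 / t * (t / 2 * |p.2|) ≤ 2 / t * Real.exp ((t / 2) * |p.2|) :=
          mul_le_mul_of_nonneg_left (by linarith) (by positivity)
        linarith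
      refine h1.trans ?_
      rw [mul_assoc, ← Real.exp_add]
      refine mul_le_mul_of_nonneg_left (Real.exp_le_exp.2 ?_) (by positivity)
      nlinarith
    · rw [Set.indicator_of_notMem (by exact hp)]
      positivity
  have hi : ∀ τ, Integrable ({p : ℝ × ℝ | τ < |p.2|}.indicator fun p => 1 + |p.2|) ν := by
    intro τ
    refine (hexp.const_mul ((1 + 2 / t) * Real.exp (-(t / 2) * τ))).mono'
      (Measurable.aestronglyMeasurable ?_) (Eventually.of_forall fun p => ?_)
    · exact Measurable.indicator (by fun_prop)
        (measurableSet_lt measurable_const (by fun_prop))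
    · rw [Real.norm_eq_abs, abs_of_nonneg (Set.indicator_nonneg (fun p _ => by positivity) p)]
      exact hpt τ p
  refine ⟨(1 + 2 / t) * E, by positivity, fun τ => ⟨hi τ, ?_⟩⟩
  refine (integral_mono (hi τ) (hexp.const_mul _) (hpt τ)).trans (le_of_eq ?_)
  rw [integral_const_mul]; ring

/-! ### Calculus of the classes `GS(c)` -/

namespace GS

variable {u v : ℕ → ℝ} {c d : ℝ}

lemma tendsto_ratio (hu : GS u c) : Tendsto (fun n : ℕ => u (n - 1) / u n) atTop (𝓝 1) := by
  have h1 : Tendsto (fun n : ℕ => ((n : ℝ))⁻¹ * ((n : ℝ) * (1 - u (n - 1) / u n))) atTop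
      (𝓝 (0 * c)) := tendsto_inv_atTop_nhds_zero_nat.mul hu.2
  have h2 : Tendsto (fun n : ℕ => 1 - ((n : ℝ))⁻¹ * ((n : ℝ) * (1 - u (n - 1) / u n))) atTop
      (𝓝 (1 - 0 * c)) := tendsto_const_nhds.sub h1
  rw [zero_mul, sub_zero] at h2
  refine h2.congr' ?_
  filter_upwards [eventually_ge_atTop 1] with n hn
  have : (n : ℝ) ≠ 0 := by positivity
  rw [inv_mul_cancel_left₀ this]; ring

/-- With `ρ` and `σ` the two ratios, `1 - ρσ = (1 - ρ) + ρ(1 - σ)`, and `ρ → 1`. -/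
lemma mul (hu : GS u c) (hv : GS v d) : GS (fun n => u n * v n) (c + d) := by
  refine ⟨fun n hn => mul_pos (hu.1 n hn) (hv.1 n hn), ?_⟩
  have h := hu.2.add (hu.tendsto_ratio.mul hv.2)
  rw [one_mul] at h
  refine h.congr fun n => ?_
  rw [mul_div_mul_comm]
  ring

lemma inv (hu : GS u c) : GS (fun n => (u n)⁻¹) (-c) := by
  refine ⟨fun n hn => inv_pos.2 (hu.1 n hn), ?_⟩
  have h := (hu.2.div hu.tendsto_ratio one_ne_zero).neg
  rw [div_one] at h
  refine h.congr' ?_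
  filter_upwards [eventually_ge_atTop 2] with n hn
  have h1 := (hu.1 n (by omega)).ne'
  have h2 := (hu.1 (n - 1) (by omega)).ne'
  simp only [Pi.div_apply]
  field_simp
  ring

/-- The factorisation `1 - ρ = (1 - √ρ)(1 + √ρ)` together with `ρ → 1` halves the index. -/
lemma sqrt (hu : GS u c) : GS (fun n => Real.sqrt (u n)) (c / 2) := by
  refine ⟨fun n hn => Real.sqrt_pos.2 (hu.1 n hn), ?_⟩
  have h0 : Tendsto (fun n : ℕ => 1 + Real.sqrt (u (n - 1) / u n)) atTop (𝓝 (1 + Real.sqrt 1)) :=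
    tendsto_const_nhds.add ((Real.continuous_sqrt.tendsto 1).comp hu.tendsto_ratio)
  have h := hu.2.div h0 (by positivity)
  rw [Real.sqrt_one, one_add_one_eq_two] at h
  refine h.congr' ?_
  filter_upwards [eventually_ge_atTop 2] with n hn
  have h1 := hu.1 n (by omega)
  have h2 := hu.1 (n - 1) (by omega)
  rw [← Real.sqrt_div h2.le]
  have h3 : 0 ≤ u (n - 1) / u n := by positivity
  have h4 : (1 : ℝ) + √(u (n - 1) / u n) ≠ 0 := by positivity
  simp only [Pi.div_apply]
  rw [div_eq_iff h4]
  nlinarith [Real.mul_self_sqrt h3]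

lemma congr (hu : GS u c) (h : ∀ n, 1 ≤ n → v n = u n) : GS v c := by
  refine ⟨fun n hn => by rw [h n hn]; exact hu.1 n hn, hu.2.congr' ?_⟩
  filter_upwards [eventually_ge_atTop 2] with n hn
  rw [h n (by omega), h (n - 1) (by omega)]

/-- The quantity is the slope of `y ↦ y^p` between `1` and `1 - 1/n`, hence tends to the derivative
`p` at `1`. -/
lemma rpow_nat (p : ℝ) : GS (fun n => (n : ℝ) ^ p) p := by
  refine ⟨fun n hn => by positivity, ?_⟩
  have hd : HasDerivAt (fun y : ℝ => y ^ p) (p * 1 ^ (p - 1)) 1 :=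
    Real.hasDerivAt_rpow_const (Or.inl one_ne_zero)
  rw [Real.one_rpow, mul_one] at hd
  have hs := hd.tendsto_slope
  have ht : Tendsto (fun n : ℕ => 1 - ((n : ℝ))⁻¹) atTop (𝓝[≠] 1) := by
    refine tendsto_nhdsWithin_iff.2 ⟨?_, ?_⟩
    · have h0 : Tendsto (fun n : ℕ => 1 - ((n : ℝ))⁻¹) atTop (𝓝 (1 - 0)) :=
        tendsto_const_nhds.sub tendsto_inv_atTop_nhds_zero_nat
      simpa only [sub_zero] using h0
    · filter_upwards [eventually_ge_atTop 1] with n hn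
      have : (0 : ℝ) < (n : ℝ)⁻¹ := by positivity
      simp only [Set.mem_compl_iff, Set.mem_singleton_iff]
      linarith
  refine (hs.comp ht).congr' ?_
  filter_upwards [eventually_ge_atTop 1] with n hn
  have hn0 : (0 : ℝ) < n := by positivity
  have e : ((n - 1 : ℕ) : ℝ) ^ p / (n : ℝ) ^ p = (1 - (n : ℝ)⁻¹) ^ p := by
    rw [← Real.div_rpow (by positivity) hn0.le]
    congr 1
    push_cast [Nat.cast_sub hn]
    field_simp
  simp only [Function.comp, slope_def_field]
  rw [e, Real.one_rpow]
  field_simp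
  ring

/-- A sequence in `GS c` with `c < 0` is bounded. -/
lemma bounded_of_neg (hu : GS u c) (hc : c < 0) : ∃ C, 0 < C ∧ ∀ n, 1 ≤ n → u n ≤ C := by
  have h1 : ∀ᶠ n : ℕ in atTop, (n : ℝ) * (1 - u (n - 1) / u n) < 0 := hu.2.eventually_lt_const hc
  obtain ⟨N, hN⟩ := eventually_atTop.1 h1
  -- A negative limit makes the ratio `u n / u (n + 1)` exceed `1`, so the sequence eventually
  -- decreases.
  have hstep : ∀ n, N + 1 ≤ n → u (n + 1) ≤ u n := by
    intro n hn
    have h2 := hN (n + 1) (by omega)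
    have h3 := hu.1 (n + 1) (by omega)
    rw [Nat.add_sub_cancel] at h2
    have h4 : 1 - u n / u (n + 1) < 0 := by
      by_contra h5
      push Not at h5
      have : (0 : ℝ) ≤ ((n + 1 : ℕ) : ℝ) := by positivity
      nlinarith [mul_nonneg this h5]
    have h5 : 1 < u n / u (n + 1) := by linarith
    exact ((one_lt_div h3).1 h5).le
  have hlate : ∀ n, N + 1 ≤ n → u n ≤ u (N + 1) := by
    intro n hn
    induction n, hn using Nat.le_induction with
    | base => exact le_rfl
    | succ k hk ih => exact (hstep k hk).trans ih
  have hpos : ∀ n ∈ Finset.range (N + 2), 0 ≤ |u n| := fun n _ => abs_nonneg _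
  refine ⟨∑ k ∈ Finset.range (N + 2), |u k| + 1,
    by linarith [Finset.sum_nonneg hpos], fun n hn => ?_⟩
  rcases le_total n (N + 1) with h | h
  · have := Finset.single_le_sum hpos (Finset.mem_range.2 (show n < N + 2 by omega))
    linarith [le_abs_self (u n)]
  · have := Finset.single_le_sum hpos (Finset.mem_range.2 (show N + 1 < N + 2 by omega))
    linarith [le_abs_self (u (N + 1)), hlate n h]

/-- Multiplication by `n^(-p)` shifts the index to `c - p < 0`, where sequences are bounded. -/
lemma le_rpow (hu : GS u c) {p : ℝ} (hp : c < p) :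
    ∃ C, 0 < C ∧ ∀ n : ℕ, 1 ≤ n → u n ≤ C * (n : ℝ) ^ p := by
  obtain ⟨C, hC, h⟩ := (hu.mul (rpow_nat (-p))).bounded_of_neg (by linarith)
  refine ⟨C, hC, fun n hn => ?_⟩
  have hn0 : (0 : ℝ) < n := by positivity
  have h1 := mul_le_mul_of_nonneg_right (h n hn) (Real.rpow_nonneg hn0.le p)
  rwa [mul_assoc, ← Real.rpow_add hn0, neg_add_cancel, Real.rpow_zero, mul_one] at h1

lemma tendsto_zero (hu : GS u c) (hc : c < 0) : Tendsto u atTop (𝓝 0) := by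
  obtain ⟨C, hC, h⟩ := hu.le_rpow (show c < c / 2 by linarith)
  have h1 : Tendsto (fun n : ℕ => C * (n : ℝ) ^ (-(-(c / 2)))) atTop (𝓝 (C * 0)) :=
    ((tendsto_rpow_neg_atTop (show 0 < -(c / 2) by linarith)).comp
      tendsto_natCast_atTop_atTop).const_mul C
  rw [mul_zero, neg_neg] at h1
  refine squeeze_zero' ?_ ?_ h1
  · filter_upwards [eventually_ge_atTop 1] with n hn using (hu.1 n hn).le
  · filter_upwards [eventually_ge_atTop 1] with n hn using h n hn

/-- The logarithm, modified at `1` to be positive, is in `GS 0`. -/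
lemma log_nat : GS (fun n : ℕ => if n = 1 then 1 else Real.log n) 0 := by
  constructor
  · intro n hn
    by_cases h : n = 1
    · simp [h]
    · simp only [h, if_false]
      exact Real.log_pos (by exact_mod_cast (show 1 < n by omega))
  -- Since `n (ln n - ln (n - 1)) ≤ n / (n - 1) ≤ 2`, the quantity lies between `0` and `2 / ln n`.
  -- Taking `n ≥ 3` keeps `n - 1` away from the modified value at `1`.
  · have hlog : Tendsto (fun n : ℕ => (Real.log n)⁻¹) atTop (𝓝 0) :=
      (Real.tendsto_log_atTop.comp tendsto_natCast_atTop_atTop).inv_tendsto_atTop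
    have h2 : Tendsto (fun n : ℕ => 2 * (Real.log n)⁻¹) atTop (𝓝 (2 * 0)) := hlog.const_mul 2
    rw [mul_zero] at h2
    refine squeeze_zero' ?_ ?_ h2
    all_goals
      filter_upwards [eventually_ge_atTop 3] with n hn
      have hn1 : n ≠ 1 := by omega
      have hn2 : n - 1 ≠ 1 := by omega
      simp only [hn1, hn2, if_false]
      have hn0 : (3 : ℝ) ≤ n := by exact_mod_cast hn
      have hl : 0 < Real.log n := Real.log_pos (by linarith)
      have hc : ((n - 1 : ℕ) : ℝ) = n - 1 := by push_cast [Nat.cast_sub (show 1 ≤ n by omega)]; ring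
      rw [hc, one_sub_div hl.ne']
    · have : Real.log (n - 1) ≤ Real.log n := Real.log_le_log (by linarith) (by linarith)
      exact mul_nonneg (by linarith) (div_nonneg (by linarith) hl.le)
    · rw [← mul_div_assoc, div_eq_mul_inv]
      refine mul_le_mul_of_nonneg_right ?_ (inv_nonneg.2 hl.le)
      have h3 : Real.log n - Real.log (n - 1) ≤ n / (n - 1) - 1 := by
        rw [← Real.log_div (by linarith) (by linarith)]
        exact Real.log_le_sub_one_of_pos (div_pos (by linarith) (by linarith))
      have h4 : (n : ℝ) / (n - 1) - 1 = 1 / (n - 1) := by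
        have : (n : ℝ) - 1 ≠ 0 := by linarith
        field_simp
        ring
      rw [h4] at h3
      calc (n : ℝ) * (Real.log n - Real.log (n - 1)) ≤ n * (1 / (n - 1)) :=
            mul_le_mul_of_nonneg_left h3 (by linarith)
        _ ≤ 2 := by
          rw [mul_one_div, div_le_iff₀ (by linarith)]; linarith

end GS

/-! ### Contraction against growth of the normalisation -/

/-- A sequence in `GS ℓ` grows slower than the contraction rate of a recursion with stepsize `γ`
and coefficient `φ`, once `lim n γ_n > ℓ / φ`. -/
lemma eventually_contraction {γ lam : ℕ → ℝ} {ℓ φ l₀ : ℝ} (hlam : GS lam ℓ) (hℓ : 0 ≤ ℓ)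
    (hφ : 0 < φ) (hγ : ∀ n, 1 ≤ n → 0 < γ n) (hγ0 : Tendsto γ atTop (𝓝 0)) (hl₀ : ℓ / φ < l₀)
    (hL : ∀ᶠ n : ℕ in atTop, l₀ < n * γ n) :
    ∃ δ κ : ℝ, 0 < δ ∧ κ < φ ∧
      ∀ᶠ n : ℕ in atTop, lam n * (1 - γ n * κ) ≤ lam (n - 1) * (1 - δ * γ n) := by
  have h1 : ℓ < l₀ * φ := (div_lt_iff₀ hφ).1 hl₀
  have hl0 : 0 < l₀ := (div_nonneg hℓ hφ.le).trans_lt hl₀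
  -- The margin `e` is shared out: with `δ = e / (4 l₀)` and `κ = φ - δ`, one has `l₀ (φ - 2δ) = ℓ +
  -- e/2`, which still dominates `n (1 - ρ)`.
  set e := l₀ * φ - ℓ with he
  have he0 : 0 < e := by linarith
  refine ⟨e / (4 * l₀), φ - e / (4 * l₀), by positivity, by
    have : 0 < e / (4 * l₀) := by positivity
    linarith, ?_⟩
  set δ := e / (4 * l₀) with hδ
  have hδ0 : 0 < δ := by positivity
  have hδl : l₀ * δ = e / 4 := by rw [hδ]; field_simp
  have h2 : ∀ᶠ n : ℕ in atTop, (n : ℝ) * (1 - lam (n - 1) / lam n) < ℓ + e / 2 :=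
    hlam.2.eventually_lt_const (by linarith)
  have h8 : ∀ᶠ n in atTop, δ * γ n < 1 :=
    (hγ0.const_mul δ).eventually_lt_const (by rw [mul_zero]; exact one_pos)
  filter_upwards [h2, hL, h8, eventually_ge_atTop 2] with n h2 h3 h8 hn
  have hn0 : (0 : ℝ) < n := by positivity
  have hp := hlam.1 n (by omega)
  have hp' := hlam.1 (n - 1) (by omega)
  have hg := hγ n (by omega)
  set ρ := lam (n - 1) / lam n with hρ
  have hρe : lam (n - 1) = lam n * ρ := by rw [hρ]; field_simp
  rw [hρe, mul_assoc]
  refine mul_le_mul_of_nonneg_left ?_ hp.le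
  have hφδ : 0 < φ - 2 * δ := by
    have : 0 < l₀ * (φ - 2 * δ) := by nlinarith
    exact (mul_pos_iff_of_pos_left hl0).1 this
  have h4 : ℓ + e / 2 ≤ n * γ n * (φ - 2 * δ) := by
    have := mul_le_mul_of_nonneg_right h3.le hφδ.le
    nlinarith
  -- After division by `lam n` the claim is `1 - γκ ≤ ρ(1 - δγ)`. The growth estimate matters only
  -- for `ρ ≤ 1`; for `ρ ≥ 1` it suffices that `δ ≤ κ`.
  rcases le_total ρ 1 with h5 | h5
  · have h6 : n * (1 - ρ) ≤ n * (γ n * (φ - 2 * δ)) := by linarith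
    have h7 : 1 - ρ ≤ γ n * (φ - 2 * δ) := le_of_mul_le_mul_left h6 hn0
    nlinarith [mul_nonneg (mul_nonneg hδ0.le hg.le) (sub_nonneg.2 h5)]
  · nlinarith [mul_nonneg (sub_nonneg.2 h5) (sub_nonneg.2 h8.le), mul_pos hg hφδ]

lemma LimStepGT.exists_between {γ : ℕ → ℝ} {c : ℝ} (h : LimStepGT γ c) :
    ∃ l₀, c < l₀ ∧ ∀ᶠ n : ℕ in atTop, l₀ < n * γ n := by
  obtain ⟨L, hL, hc⟩ := h
  obtain ⟨l, h1, h2⟩ := EReal.exists_between_coe_real hc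
  refine ⟨l, by exact_mod_cast h1, ?_⟩
  filter_upwards [hL.eventually_const_lt h2] with n hn
  exact_mod_cast hn

/-! ### One step of the exponential Lyapunov bound -/

/-- Kernel statistics of the law `ν` around `x`, with density value `f` and regression value `θ`. -/
structure KernelMoments (ν : Measure (ℝ × ℝ)) (K : ℝ → ℝ) (C x f θ η : ℝ) : Prop where
  integrable : ∀ q : ℕ, q ≤ 2 → Integrable (fun p : ℝ × ℝ => scaledKernel K η x p.1 * p.2 ^ q) ν
  integral_le : ∀ q : ℕ, q ≤ 2 → ∫ p, scaledKernel K η x p.1 * p.2 ^ q ∂ν ≤ C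
  bias_density : |∫ p, scaledKernel K η x p.1 ∂ν - f| ≤ C * η ^ 2
  bias_response : |∫ p, scaledKernel K η x p.1 * p.2 ∂ν - θ * f| ≤ C * η ^ 2

/-- Exponential Lyapunov bound for one step of the recursion started from a frozen error `ρ`. -/
lemma exp_error_step {ν : Measure (ℝ × ℝ)} [IsProbabilityMeasure ν] {K : ℝ → ℝ}
    (hKc : Continuous K) (hK0 : ∀ z, 0 ≤ K z) {Q : ℝ} (hQ : ∀ z, K z ≤ Q)
    {C x f θ η γ lam τ ρ R T : ℝ} (hη : 0 < η) (hγ : 0 < γ) (hlam : 0 ≤ lam)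
    (hm : KernelMoments ν K C x f θ η) (hθ : |θ| ≤ R)
    (hTi : Integrable ({p : ℝ × ℝ | τ < |p.2|}.indicator fun p => 1 + |p.2|) ν)
    (hT : ∫ p, {p : ℝ × ℝ | τ < |p.2|}.indicator (fun p => 1 + |p.2|) p ∂ν ≤ T)
    (hsmall : lam * γ * (η⁻¹ * Q) * (τ + R + |ρ|) ≤ 1) (hstep : γ * (η⁻¹ * Q) ≤ 1) :
    ∫⁻ p, {p : ℝ × ℝ | |p.2| ≤ τ}.indicator (fun p => ENNReal.ofReal (Real.exp (lam *
        |ρ * (1 - γ * scaledKernel K η x p.1) + γ * scaledKernel K η x p.1 * (p.2 - θ)|))) p ∂ν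
      ≤ ENNReal.ofReal (Real.exp (lam * |ρ| + γ * (lam * (C * (1 + R) * η ^ 2
          - |ρ| * (f - C * η ^ 2)) + lam ^ 2 * γ * (η⁻¹ * Q) * (3 * C * (1 + R ^ 2 + ρ ^ 2))
          + lam * (η⁻¹ * Q) * (1 + R + |ρ|) * T)) + Real.exp 1) := by
  set Z : ℝ × ℝ → ℝ := fun p => scaledKernel K η x p.1 with hZ
  have hR : 0 ≤ R := (abs_nonneg _).trans hθ
  have hQ0 : 0 ≤ Q := (hK0 0).trans (hQ 0)
  have hq0 : 0 ≤ η⁻¹ * Q := by positivity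
  have hZ0 : ∀ p, 0 ≤ Z p := fun p => scaledKernel_nonneg hK0 hη x p.1
  have hZQ : ∀ p, Z p ≤ η⁻¹ * Q := fun p => scaledKernel_le hQ hη x p.1
  have hρ0 := abs_nonneg ρ
  set w := η⁻¹ * Q with hw
  have hZm : Measurable Z := (continuous_scaledKernel hKc η x).measurable.comp measurable_fst
  -- The sign of the old error linearises the absolute value: if `ρ'` is the new error, then `lam
  -- σρ' = lam |ρ| + u`, and `|ρ'|` is `σρ'` unless the sign flips.
  obtain ⟨σ, hσ, hσρ⟩ : ∃ σ : ℝ, (σ = 1 ∨ σ = -1) ∧ σ * ρ = |ρ| := by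
    rcases le_total 0 ρ with h | h
    · exact ⟨1, Or.inl rfl, by rw [abs_of_nonneg h, one_mul]⟩
    · exact ⟨-1, Or.inr rfl, by rw [abs_of_nonpos h]; ring⟩
  have hσ2 : σ * σ = 1 := by rcases hσ with h | h <;> rw [h] <;> norm_num
  have hσa : ∀ y, |σ * y| = |y| := fun y => by
    rcases hσ with h | h <;> rw [h] <;> simp
  set u : ℝ × ℝ → ℝ := fun p => lam * γ * Z p * (σ * (p.2 - θ) - |ρ|) with hu
  have hu_abs : ∀ p, |u p| ≤ lam * γ * w * (|p.2| + R + |ρ|) := by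
    intro p
    have h1 : |σ * (p.2 - θ) - (|ρ|)| ≤ |p.2| + R + |ρ| := by
      refine (abs_sub _ _).trans ?_
      rw [hσa, abs_abs]
      linarith [abs_sub p.2 θ]
    rw [hu]
    simp only [abs_mul, abs_of_nonneg hlam, abs_of_pos hγ, abs_of_nonneg (hZ0 p)]
    exact mul_le_mul (mul_le_mul_of_nonneg_left (hZQ p) (by positivity)) h1 (abs_nonneg _)
      (by positivity)
  set S := {p : ℝ × ℝ | τ < |p.2|} with hS
  have hSm : MeasurableSet S := measurableSet_lt measurable_const (by fun_prop)
  set V : ℝ × ℝ → ℝ := fun p => S.indicator (fun p => 1 + |p.2|) p with hV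
  have hV0 : ∀ p, 0 ≤ V p := fun p => Set.indicator_nonneg (fun p _ => by positivity) p
  set b := lam * γ * w * (1 + R + |ρ|) with hb
  have hb0 : 0 ≤ b := by positivity
  -- The truncated integrand is dominated by a function integrated over the whole plane, where the
  -- kernel moments are known. This is legitimate because `1 + u + u² ≥ 0` even where `u` is large.
  -- The constant `e` covers sign flips.
  set Φ : ℝ × ℝ → ℝ := fun p => Real.exp (lam * |ρ|) * (1 + u p + u p ^ 2 + b * V p)
    + Real.exp 1 with hΦ
  have hΦ0 : ∀ p, 0 ≤ Φ p := by
    intro p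
    have h1 : 0 ≤ 1 + u p + u p ^ 2 := by nlinarith [sq_nonneg (u p + 1)]
    have := mul_nonneg hb0 (hV0 p)
    have h2 := Real.exp_pos (lam * |ρ|)
    have h3 := Real.exp_pos 1
    simp only [hΦ]
    have := mul_nonneg h2.le (add_nonneg h1 this)
    linarith
  have hpt : ∀ p : ℝ × ℝ, |p.2| ≤ τ → Real.exp (lam *
      |ρ * (1 - γ * Z p) + γ * Z p * (p.2 - θ)|) ≤ Φ p := by
    intro p hp
    have hu1 : |u p| ≤ 1 := by
      refine (hu_abs p).trans (le_trans ?_ hsmall)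
      exact mul_le_mul_of_nonneg_left (by linarith) (by positivity)
    have hexpu : Real.exp (u p) ≤ 1 + u p + u p ^ 2 := by
      have := (abs_le.1 (Real.abs_exp_sub_one_sub_id_le hu1)).2
      linarith
    have hZγ : γ * Z p ≤ 1 := (mul_le_mul_of_nonneg_left (hZQ p) hγ.le).trans hstep
    set ρ' := ρ * (1 - γ * Z p) + γ * Z p * (p.2 - θ)
    have h1 : lam * (σ * ρ') = lam * |ρ| + u p := by
      simp only [ρ', hu]
      rw [← hσρ]; ring
    have h1u : 0 ≤ 1 + u p + u p ^ 2 := by nlinarith [sq_nonneg (u p + 1)]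
    have h2 := Real.exp_pos (lam * |ρ|)
    have h3 := Real.exp_pos 1
    have hbV := mul_nonneg hb0 (hV0 p)
    rcases le_total 0 (σ * ρ') with h | h
    · rw [← hσa, abs_of_nonneg h, h1, Real.exp_add]
      have := mul_le_mul_of_nonneg_left (show Real.exp (u p) ≤ 1 + u p + u p ^ 2 + b * V p by
        linarith) h2.le
      simp only [hΦ]
      linarith
    -- If the sign flips, the old error, whose coefficient is nonnegative, only reduces `|ρ'|`. A
    -- single noise term remains, and `hsmall` bounds its exponent by `1`.
    · have h4 : |ρ'| ≤ γ * Z p * |p.2 - θ| := by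
        rw [← hσa, abs_of_nonpos h]
        have h5 : σ * ρ' = |ρ| * (1 - γ * Z p) + γ * Z p * (σ * (p.2 - θ)) := by
          rw [← hσρ]; simp only [ρ']; ring
        have h6 := neg_abs_le (σ * (p.2 - θ))
        rw [hσa] at h6
        have h7 := mul_le_mul_of_nonneg_left h6 (mul_nonneg hγ.le (hZ0 p))
        have h8 := mul_nonneg hρ0 (sub_nonneg.2 hZγ)
        linarith
      have h9 : lam * |ρ'| ≤ 1 := by
        calc lam * |ρ'| ≤ lam * (γ * Z p * |p.2 - θ|) := mul_le_mul_of_nonneg_left h4 hlam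
          _ ≤ lam * (γ * w * (τ + R + |ρ|)) := by
            refine mul_le_mul_of_nonneg_left (mul_le_mul
              (mul_le_mul_of_nonneg_left (hZQ p) hγ.le) ?_ (abs_nonneg _) (by positivity)) hlam
            linarith [abs_sub p.2 θ]
          _ ≤ 1 := by linarith
      have h10 := Real.exp_le_exp.2 h9
      have := mul_nonneg h2.le (add_nonneg h1u hbV)
      simp only [hΦ]
      linarith
  have hZi : Integrable Z ν := by simpa using hm.integrable 0 (by norm_num)
  have hZyi : Integrable (fun p => Z p * p.2) ν := by simpa using hm.integrable 1 (by norm_num)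
  have hZyyi : Integrable (fun p => Z p * p.2 ^ 2) ν := hm.integrable 2 le_rfl
  have hueq : ∀ p, u p = lam * γ * (σ * (Z p * p.2) - (σ * θ + |ρ|) * Z p) := fun p => by
    simp only [hu]; ring
  have hui : Integrable u ν := by
    refine (((hZyi.const_mul σ).sub (hZi.const_mul (σ * θ + |ρ|))).const_mul
      (lam * γ)).congr (Eventually.of_forall fun p => (hueq p).symm)
  -- The drift splits into `σ(E[ZY] - θ E Z)`, where the main terms `θ f` cancel and a bias `O(η²)`
  -- is left, and `-|ρ| E Z`, which is the contraction.
  have hu_int : ∫ p, u p ∂ν ≤ lam * γ * (C * (1 + R) * η ^ 2 - |ρ| * (f - C * η ^ 2)) := by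
    simp_rw [hueq]
    rw [integral_const_mul, integral_sub (hZyi.const_mul _) (hZi.const_mul _),
      integral_const_mul, integral_const_mul]
    refine mul_le_mul_of_nonneg_left ?_ (by positivity)
    set EZ := ∫ p, Z p ∂ν
    set EW := ∫ p, Z p * p.2 ∂ν
    have h0 : |EZ - f| ≤ C * η ^ 2 := hm.bias_density
    have h1 : |EW - θ * f| ≤ C * η ^ 2 := hm.bias_response
    have h2 : σ * (EW - θ * EZ) ≤ C * (1 + R) * η ^ 2 := by
      refine (le_abs_self _).trans ?_
      rw [hσa]
      have e : EW - θ * EZ = (EW - θ * f) - θ * (EZ - f) := by ring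
      rw [e]
      refine (abs_sub _ _).trans ?_
      rw [abs_mul]
      have := mul_le_mul hθ h0 (abs_nonneg _) hR
      linarith
    have h3 : |ρ| * (f - C * η ^ 2) ≤ |ρ| * EZ :=
      mul_le_mul_of_nonneg_left (by linarith [(abs_le.1 h0).1]) hρ0
    linarith
  have husq : ∀ p, u p ^ 2 ≤ lam ^ 2 * γ ^ 2 * w *
      (3 * (Z p * p.2 ^ 2) + 3 * (R ^ 2 + ρ ^ 2) * Z p) := by
    intro p
    have h1 : (σ * (p.2 - θ) - |ρ|) ^ 2 ≤ 3 * p.2 ^ 2 + 3 * (R ^ 2 + ρ ^ 2) := by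
      have hs : (σ * (p.2 - θ)) ^ 2 = (p.2 - θ) ^ 2 := by
        rw [← sq_abs, hσa, sq_abs]
      have hθ2 : θ ^ 2 ≤ R ^ 2 := by rw [← sq_abs]; exact pow_le_pow_left₀ (abs_nonneg _) hθ 2
      have hr2 := sq_abs ρ
      have hσs : σ ^ 2 = 1 := by rw [sq, hσ2]
      have : (σ * (p.2 - θ) - |ρ|) ^ 2 ≤ 3 * p.2 ^ 2 + 3 * θ ^ 2 + 3 * |ρ| ^ 2 := by
        have e : σ * (p.2 - θ) - |ρ| = σ * p.2 + (-(σ * θ)) + (-|ρ|) := by ring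
        have e1 : (σ * p.2) ^ 2 = p.2 ^ 2 := by rw [mul_pow, hσs, one_mul]
        have e2 : (-(σ * θ)) ^ 2 = θ ^ 2 := by rw [neg_sq, mul_pow, hσs, one_mul]
        have e3 : (-|ρ|) ^ 2 = |ρ| ^ 2 := neg_sq _
        rw [e]
        nlinarith [sq_nonneg (σ * p.2 - (-(σ * θ))), sq_nonneg (σ * p.2 - (-|ρ|)),
          sq_nonneg (-(σ * θ) - (-|ρ|))]
      linarith
    -- One factor `Z` is bounded by its supremum and the other is integrated, so the second moment
    -- costs a single power of `η⁻¹`.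
    have h2 : Z p ^ 2 ≤ w * Z p := by
      rw [sq]; exact mul_le_mul_of_nonneg_right (hZQ p) (hZ0 p)
    calc u p ^ 2 = lam ^ 2 * γ ^ 2 * (Z p ^ 2 * (σ * (p.2 - θ) - |ρ|) ^ 2) := by
          simp only [hu]; ring
      _ ≤ lam ^ 2 * γ ^ 2 * ((w * Z p) * (3 * p.2 ^ 2 + 3 * (R ^ 2 + ρ ^ 2))) := by
          refine mul_le_mul_of_nonneg_left ?_ (by positivity)
          exact mul_le_mul h2 h1 (sq_nonneg _) (mul_nonneg hq0 (hZ0 p))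
      _ = _ := by ring
  have hbig : Integrable (fun p => lam ^ 2 * γ ^ 2 * w *
      (3 * (Z p * p.2 ^ 2) + 3 * (R ^ 2 + ρ ^ 2) * Z p)) ν :=
    ((hZyyi.const_mul 3).add (hZi.const_mul _)).const_mul _
  have hum : Measurable u := by
    simp only [hu]; fun_prop
  have hu2i : Integrable (fun p => u p ^ 2) ν := by
    refine hbig.mono' (hum.pow_const 2).aestronglyMeasurable (Eventually.of_forall fun p => ?_)
    rw [Real.norm_eq_abs, abs_of_nonneg (sq_nonneg _)]
    exact husq p
  have hu2_int : ∫ p, u p ^ 2 ∂ν ≤ lam ^ 2 * γ ^ 2 * w * (3 * C * (1 + R ^ 2 + ρ ^ 2)) := by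
    refine (integral_mono hu2i hbig husq).trans ?_
    rw [integral_const_mul, integral_add (hZyyi.const_mul 3) (hZi.const_mul _),
      integral_const_mul, integral_const_mul]
    refine mul_le_mul_of_nonneg_left ?_ (by positivity)
    have h2 : ∫ p, Z p * p.2 ^ 2 ∂ν ≤ C := hm.integral_le 2 le_rfl
    have h0 : ∫ p, Z p ∂ν ≤ C := by simpa using hm.integral_le 0 (by norm_num)
    have := mul_le_mul_of_nonneg_left h0 (show 0 ≤ 3 * (R ^ 2 + ρ ^ 2) by positivity)
    linarith
  have hVi : Integrable V ν := hTi
  have hΦi : Integrable Φ ν :=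
    ((((integrable_const (1 : ℝ)).add hui).add hu2i).add (hVi.const_mul b)).const_mul _
      |>.add (integrable_const _)
  have hΦint : ∫ p, Φ p ∂ν = Real.exp (lam * |ρ|) *
      (1 + ∫ p, u p ∂ν + ∫ p, u p ^ 2 ∂ν + b * ∫ p, V p ∂ν) + Real.exp 1 := by
    have i1 : Integrable (fun p => 1 + u p) ν := (integrable_const (1 : ℝ)).add hui
    have i2 : Integrable (fun p => 1 + u p + u p ^ 2) ν := i1.add hu2i
    have i3 : Integrable (fun p => 1 + u p + u p ^ 2 + b * V p) ν := i2.add (hVi.const_mul b)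
    simp only [hΦ]
    rw [integral_add (i3.const_mul _) (integrable_const _), integral_const_mul,
      integral_add i2 (hVi.const_mul b), integral_add i1 hu2i,
      integral_add (integrable_const _) hui, integral_const_mul]
    simp
  have hle : ∫ p, Φ p ∂ν ≤ Real.exp (lam * |ρ| + γ * (lam * (C * (1 + R) * η ^ 2
          - |ρ| * (f - C * η ^ 2)) + lam ^ 2 * γ * w * (3 * C * (1 + R ^ 2 + ρ ^ 2))
          + lam * w * (1 + R + |ρ|) * T)) + Real.exp 1 := by
    rw [hΦint, Real.exp_add]
    refine add_le_add_left (mul_le_mul_of_nonneg_left ?_ (Real.exp_pos _).le) _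
    have hVT : b * ∫ p, V p ∂ν ≤ b * T := mul_le_mul_of_nonneg_left hT hb0
    refine le_trans ?_ (Real.add_one_le_exp _)
    have e1 : γ * (lam * (C * (1 + R) * η ^ 2
          - |ρ| * (f - C * η ^ 2)) + lam ^ 2 * γ * w * (3 * C * (1 + R ^ 2 + ρ ^ 2))
          + lam * w * (1 + R + |ρ|) * T) = lam * γ * (C * (1 + R) * η ^ 2 - |ρ| * (f - C * η ^ 2))
          + lam ^ 2 * γ ^ 2 * w * (3 * C * (1 + R ^ 2 + ρ ^ 2)) + b * T := by
      rw [hb]; ring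
    rw [e1]
    linarith
  refine le_trans ?_ (ENNReal.ofReal_le_ofReal hle)
  rw [ofReal_integral_eq_lintegral_ofReal hΦi (Eventually.of_forall hΦ0)]
  refine lintegral_mono fun p => ?_
  by_cases hp : |p.2| ≤ τ
  · rw [Set.indicator_of_mem (by exact hp)]
    exact ENNReal.ofReal_le_ofReal (hpt p hp)
  · rw [Set.indicator_of_notMem (by exact hp)]
    exact zero_le

/-! ### Rate conditions and their consequences -/

/-- Conditions on stepsizes, bandwidths and normalisation `lam` under which the error of the
estimator is `O(ln n / lam n)`. -/
structure RateConditions (γ h lam : ℕ → ℝ) (φ : ℝ) : Prop where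
  step_pos : ∀ n, 1 ≤ n → 0 < γ n
  band_pos : ∀ n, 1 ≤ n → 0 < h n
  norm_pos : ∀ n, 1 ≤ n → 0 < lam n
  step_tendsto : Tendsto γ atTop (𝓝 0)
  band_tendsto : Tendsto h atTop (𝓝 0)
  ratio_tendsto : Tendsto (fun n : ℕ => Real.sqrt (γ n * (h n)⁻¹) * Real.log n) atTop (𝓝 0)
  band_inv_le : ∃ C : ℝ, 0 < C ∧ ∀ n : ℕ, 1 ≤ n → (h n)⁻¹ ≤ C * n
  bias : ∃ C : ℝ, 0 < C ∧ ∀ᶠ n : ℕ in atTop, lam n * h n ^ 2 ≤ C * Real.log n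
  variance : ∃ C : ℝ, 0 < C ∧ ∀ᶠ n : ℕ in atTop, lam n ^ 2 * (γ n * (h n)⁻¹) ≤ C
  contraction : ∃ δ κ : ℝ, 0 < δ ∧ κ < φ ∧
    ∀ᶠ n : ℕ in atTop, lam n * (1 - γ n * κ) ≤ lam (n - 1) * (1 - δ * γ n)

namespace RateConditions

variable {γ h lam : ℕ → ℝ} {φ : ℝ}

lemma eventually_one_le_log : ∀ᶠ n : ℕ in atTop, 1 ≤ Real.log n :=
  (Real.tendsto_log_atTop.comp tendsto_natCast_atTop_atTop).eventually_ge_atTop 1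

lemma ratio_tendsto_zero (H : RateConditions γ h lam φ) :
    Tendsto (fun n : ℕ => γ n * (h n)⁻¹) atTop (𝓝 0) := by
  have h1 := H.ratio_tendsto.pow 2
  rw [zero_pow two_ne_zero] at h1
  refine squeeze_zero' ?_ ?_ h1
  · filter_upwards [eventually_ge_atTop 1] with n hn
    exact (mul_pos (H.step_pos n hn) (inv_pos.2 (H.band_pos n hn))).le
  · filter_upwards [eventually_ge_atTop 1, eventually_one_le_log] with n hn hl
    have h2 := (mul_pos (H.step_pos n hn) (inv_pos.2 (H.band_pos n hn))).le
    rw [mul_pow, Real.sq_sqrt h2]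
    exact le_mul_of_one_le_right h2 (one_le_pow₀ hl)

/-- The product factors as `(lam √(γ/h)) (√(γ/h) ln n)`, bounded times null. It makes the exponent
increment small for errors of size `O(ln n)`, and the part of the noise quadratic in `ρ` negligible
against the contraction. -/
lemma norm_ratio_log_tendsto_zero (H : RateConditions γ h lam φ) :
    Tendsto (fun n : ℕ => lam n * (γ n * (h n)⁻¹) * Real.log n) atTop (𝓝 0) := by
  obtain ⟨C, hC, hv⟩ := H.variance
  have h1 := H.ratio_tendsto.const_mul (Real.sqrt C)
  rw [mul_zero] at h1
  refine squeeze_zero' ?_ ?_ h1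
  · filter_upwards [eventually_ge_atTop 1, eventually_one_le_log] with n hn hl
    have := (mul_pos (H.step_pos n hn) (inv_pos.2 (H.band_pos n hn))).le
    exact mul_nonneg (mul_nonneg (H.norm_pos n hn).le this) (by linarith)
  · filter_upwards [eventually_ge_atTop 1, eventually_one_le_log, hv] with n hn hl hv
    have h2 := (mul_pos (H.step_pos n hn) (inv_pos.2 (H.band_pos n hn))).le
    have h3 : lam n * Real.sqrt (γ n * (h n)⁻¹) ≤ Real.sqrt C := by
      refine Real.le_sqrt_of_sq_le ?_
      rwa [mul_pow, Real.sq_sqrt h2]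
    have h4 : lam n * (γ n * (h n)⁻¹) * Real.log n
        = (lam n * Real.sqrt (γ n * (h n)⁻¹)) * (Real.sqrt (γ n * (h n)⁻¹) * Real.log n) := by
      have := Real.mul_self_sqrt h2
      calc _ = lam n * (Real.sqrt (γ n * (h n)⁻¹) * Real.sqrt (γ n * (h n)⁻¹)) * Real.log n := by
            rw [this]
        _ = _ := by ring
    rw [h4]
    exact mul_le_mul_of_nonneg_right h3 (mul_nonneg (Real.sqrt_nonneg _) (by linarith))

/-- The bias condition gives `lam ≤ C ln n / h²`, and `1/h` is `O(n)`. This polynomial size is what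
the tail term and the grid mesh have to beat. -/
lemma norm_le (H : RateConditions γ h lam φ) :
    ∃ C : ℝ, 0 < C ∧ ∀ᶠ n : ℕ in atTop, lam n ≤ C * n ^ 2 * Real.log n := by
  obtain ⟨C, hC, hb⟩ := H.bias
  obtain ⟨B, hB, hB'⟩ := H.band_inv_le
  refine ⟨C * B ^ 2, by positivity, ?_⟩
  filter_upwards [hb, eventually_ge_atTop 1, eventually_one_le_log] with n hb hn hl
  have hp := H.band_pos n hn
  have h1 := pow_le_pow_left₀ (inv_pos.2 hp).le (hB' n hn) 2
  have h2 : lam n = lam n * h n ^ 2 * (h n)⁻¹ ^ 2 := by field_simp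
  rw [h2]
  calc _ ≤ (C * Real.log n) * (B * n) ^ 2 :=
        mul_le_mul hb h1 (by positivity) (by positivity)
    _ = _ := by ring

end RateConditions

/-! ### One step in the asymptotic regime -/

/-- Either the contraction absorbs the noise, or the exponent is logarithmic. -/
lemma exp_contraction_dichotomy {s δ γ A : ℝ} {n D₀ : ℕ} (hs : 0 ≤ s) (hδ : 0 < δ) (hγ : 0 < γ)
    (hγ1 : γ ≤ 1) (hA : 0 ≤ A) (hn : 3 ≤ n) (hl : 1 ≤ Real.log n)
    (hD₀ : A / δ + A ≤ D₀) :
    Real.exp (s * (1 - δ * γ) + γ * A * Real.log n) + Real.exp 1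
      ≤ Real.exp s + (n : ℝ) ^ (D₀ + 2) := by
  have hn0 : (0 : ℝ) < n := by positivity
  have hn3 : (3 : ℝ) ≤ n := by exact_mod_cast hn
  have hnD : Real.exp 1 + (n : ℝ) ^ D₀ ≤ (n : ℝ) ^ (D₀ + 2) := by
    have h1 : Real.exp 1 ≤ 3 := by linarith [Real.exp_one_lt_d9]
    have h2 : (1 : ℝ) ≤ (n : ℝ) ^ D₀ := one_le_pow₀ (by linarith)
    have h3 : (9 : ℝ) ≤ (n : ℝ) ^ 2 := by nlinarith
    rw [pow_add]
    nlinarith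
  have hnD0 : (0 : ℝ) ≤ (n : ℝ) ^ D₀ := by positivity
  -- Above the threshold `(A/δ) ln n` the loss `δγs` pays for `γ A ln n`. Below it the exponent is
  -- at most `(A/δ + A) ln n`, so the exponential is at most `n^D₀`.
  rcases le_total (A / δ * Real.log n) s with hc | hc
  · have h1 : s * (1 - δ * γ) + γ * A * Real.log n ≤ s := by
      have h2 : γ * (δ * (A / δ * Real.log n)) ≤ γ * (δ * s) :=
        mul_le_mul_of_nonneg_left (mul_le_mul_of_nonneg_left hc hδ.le) hγ.le
      have h3 : δ * (A / δ * Real.log n) = A * Real.log n := by field_simp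
      rw [h3] at h2
      linarith
    linarith [Real.exp_le_exp.2 h1]
  · have h1 : s * (1 - δ * γ) + γ * A * Real.log n ≤ D₀ * Real.log n := by
      have h2 : 0 ≤ s * (δ * γ) := by positivity
      have h3 : γ * (A * Real.log n) ≤ 1 * (A * Real.log n) :=
        mul_le_mul_of_nonneg_right hγ1 (by positivity)
      have h4 : (A / δ + A) * Real.log n ≤ D₀ * Real.log n :=
        mul_le_mul_of_nonneg_right hD₀ (by linarith)
      linarith
    have h5 : Real.exp (D₀ * Real.log n) = (n : ℝ) ^ D₀ := by
      rw [Real.exp_nat_mul, Real.exp_log hn0]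
    have h6 := Real.exp_le_exp.2 h1
    rw [h5] at h6
    linarith [Real.exp_pos s]

set_option maxHeartbeats 800000 in
/-- One step of the recursion in the asymptotic regime. -/
lemma exp_error_step_eventually {ν : Measure (ℝ × ℝ)} [IsProbabilityMeasure ν] {K : ℝ → ℝ}
    (hA1 : AssumptionA1 K) {γ h lam : ℕ → ℝ} {φ : ℝ} (H : RateConditions γ h lam φ)
    {I : Set ℝ} {f θ : ℝ → ℝ} {C R t : ℝ} (hC : 0 ≤ C) (ht : 0 < t)
    (hexp : Integrable (fun p : ℝ × ℝ => Real.exp (t * |p.2|)) ν)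
    (hm : ∀ x ∈ I, ∀ η, 0 < η → KernelMoments ν K C x (f x) (θ x) η)
    (hf : ∀ x ∈ I, φ ≤ f x) (hθ : ∀ x ∈ I, |θ x| ≤ R) {M C₁ : ℝ} (hM : 0 ≤ M) (hC₁ : 0 ≤ C₁) :
    ∃ D : ℕ, ∀ᶠ n : ℕ in atTop, ∀ x ∈ I, ∀ ρ : ℝ, |ρ| ≤ C₁ * Real.log n →
      ∫⁻ p, {p : ℝ × ℝ | |p.2| ≤ M + 8 / t * Real.log n}.indicator (fun p =>
        ENNReal.ofReal (Real.exp (lam n *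
        |ρ * (1 - γ n * scaledKernel K (h n) x p.1)
          + γ n * scaledKernel K (h n) x p.1 * (p.2 - θ x)|))) p ∂ν
      ≤ ENNReal.ofReal (Real.exp (lam (n - 1) * |ρ|)) + ENNReal.ofReal ((n : ℝ) ^ D) := by
  rcases I.eq_empty_or_nonempty with rfl | ⟨x₀, hx₀⟩
  · exact ⟨0, by simp⟩
  have hR : 0 ≤ R := (abs_nonneg _).trans (hθ x₀ hx₀)
  obtain ⟨Q, hQ⟩ := hA1.bounded
  have hQ0 : 0 ≤ Q := (hA1.nonneg 0).trans (hQ 0)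
  obtain ⟨Cb, hCb, hbias⟩ := H.bias
  obtain ⟨Cv, hCv, hvar⟩ := H.variance
  obtain ⟨B, hB, hB'⟩ := H.band_inv_le
  obtain ⟨δ, κ, hδ, hκ, hcon⟩ := H.contraction
  obtain ⟨CT, hCT, htail⟩ := exp_tail_bound ht hexp
  obtain ⟨Cl, hCl, hlamle⟩ := H.norm_le
  -- The three summands bound the bias, the part of the noise independent of `ρ`, and the tail term,
  -- each in units of `ln n`.
  set A := C * (1 + R) * Cb + Cv * Q * (3 * C * (1 + R ^ 2)) + Cl * B * Q * (1 + R + C₁) * CT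
    with hA
  have hA0 : 0 ≤ A := by positivity
  obtain ⟨D₀, hD₀⟩ := exists_nat_ge (A / δ + A)
  refine ⟨D₀ + 2, ?_⟩
  have hsm1 : ∀ᶠ n : ℕ in atTop,
      Q * (M + 8 / t + R + C₁) * (lam n * (γ n * (h n)⁻¹) * Real.log n) < 1 :=
    (H.norm_ratio_log_tendsto_zero.const_mul _).eventually_lt_const (by rw [mul_zero]; exact one_pos)
  have hsm2 : ∀ᶠ n : ℕ in atTop, Q * (γ n * (h n)⁻¹) < 1 :=
    (H.ratio_tendsto_zero.const_mul _).eventually_lt_const (by rw [mul_zero]; exact one_pos)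
  -- The spare room `φ - κ` pays for the bias in the density and for the quadratic noise, in which
  -- `ρ²` is at most `|ρ| C₁ ln n`.
  have hsm3 : ∀ᶠ n : ℕ in atTop, C * h n ^ 2 +
      3 * C * Q * C₁ * (lam n * (γ n * (h n)⁻¹) * Real.log n) < φ - κ := by
    refine ((H.band_tendsto.pow 2).const_mul C |>.add
      (H.norm_ratio_log_tendsto_zero.const_mul (3 * C * Q * C₁))).eventually_lt_const ?_
    simp only [ne_eq, OfNat.ofNat_ne_zero, not_false_eq_true, zero_pow, mul_zero, add_zero]
    linarith
  have hsm5 : ∀ᶠ n : ℕ in atTop, γ n < 1 := H.step_tendsto.eventually_lt_const one_pos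
  filter_upwards [hbias, hvar, hcon, hlamle, hsm1, hsm2, hsm3, hsm5,
    eventually_ge_atTop 3, RateConditions.eventually_one_le_log] with
    n hbias hvar hcon hlamle hsm1 hsm2 hsm3 hsm5 hn hl x hx ρ hρ
  have hn0 : (0 : ℝ) < n := by positivity
  have hn3 : (3 : ℝ) ≤ n := by exact_mod_cast hn
  have hγ := H.step_pos n (by omega)
  have hη := H.band_pos n (by omega)
  have hlam := H.norm_pos n (by omega)
  have hlam' := H.norm_pos (n - 1) (by omega)
  have hBn := hB' n (by omega)
  have hηi : 0 < (h n)⁻¹ := inv_pos.2 hη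
  set L := Real.log n with hL
  have hρ0 := abs_nonneg ρ
  have hLn : L ≤ n := (Real.log_le_sub_one_of_pos hn0).trans (by linarith)
  have hτ : M + 8 / t * L + R + |ρ| ≤ (M + 8 / t + R + C₁) * L := by
    have h1 : M ≤ M * L := le_mul_of_one_le_right hM hl
    have h2 : R ≤ R * L := le_mul_of_one_le_right hR hl
    linarith
  have hstep := exp_error_step (ν := ν) hA1.continuous hA1.nonneg hQ
    (τ := M + 8 / t * L) (ρ := ρ) hη hγ hlam.le
    (hm x hx (h n) hη) (hθ x hx) (htail _).1 (htail (M + 8 / t * L)).2 (by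
      calc lam n * γ n * ((h n)⁻¹ * Q) * (M + 8 / t * L + R + |ρ|)
          ≤ lam n * γ n * ((h n)⁻¹ * Q) * ((M + 8 / t + R + C₁) * L) :=
            mul_le_mul_of_nonneg_left hτ (by positivity)
        _ = Q * (M + 8 / t + R + C₁) * (lam n * (γ n * (h n)⁻¹) * L) := by ring
        _ ≤ 1 := hsm1.le) (by linarith)
  refine hstep.trans ?_
  rw [← ENNReal.ofReal_add (Real.exp_pos _).le (by positivity)]
  refine ENNReal.ofReal_le_ofReal ?_
  set T := CT * Real.exp (-(t / 2) * (M + 8 / t * L)) with hT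
  -- The cutoff constant `8/t` gives `exp(-(t/2)(8/t) ln n) = n⁻⁴`, enough for the factors `n²` from
  -- `lam`, `n` from `1/h` and one extra logarithm.
  have hTn : T * n ^ 4 ≤ CT := by
    have e : Real.exp (-(t / 2) * (M + 8 / t * L)) ≤ ((n : ℝ) ^ 4)⁻¹ := by
      have h1 : -(t / 2) * (M + 8 / t * L) ≤ -(4 * L) := by
        have : t / 2 * (8 / t * L) = 4 * L := by field_simp; ring
        nlinarith [mul_nonneg ht.le hM]
      refine (Real.exp_le_exp.2 h1).trans (le_of_eq ?_)
      rw [Real.exp_neg, show (4 : ℝ) * L = ((4 : ℕ) : ℝ) * L by norm_num, Real.exp_nat_mul,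
        hL, Real.exp_log hn0]
    have h2 := mul_le_mul_of_nonneg_right e (show (0 : ℝ) ≤ (n : ℝ) ^ 4 by positivity)
    rw [inv_mul_cancel₀ (by positivity)] at h2
    calc T * n ^ 4 = CT * (Real.exp (-(t / 2) * (M + 8 / t * L)) * n ^ 4) := by rw [hT]; ring
      _ ≤ CT * 1 := mul_le_mul_of_nonneg_left h2 hCT
      _ = CT := mul_one _
  have hT0 : 0 ≤ T := by positivity
  have hexpo : lam n * (C * (1 + R) * h n ^ 2 - |ρ| * (f x - C * h n ^ 2))
      + lam n ^ 2 * γ n * ((h n)⁻¹ * Q) * (3 * C * (1 + R ^ 2 + ρ ^ 2))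
      + lam n * ((h n)⁻¹ * Q) * (1 + R + |ρ|) * T ≤ A * L - lam n * |ρ| * κ := by
    have t1 : lam n * (C * (1 + R) * h n ^ 2) ≤ C * (1 + R) * Cb * L := by
      have := mul_le_mul_of_nonneg_left hbias (show 0 ≤ C * (1 + R) by positivity)
      linarith
    have t2 : lam n ^ 2 * γ n * ((h n)⁻¹ * Q) * (3 * C * (1 + R ^ 2))
        ≤ Cv * Q * (3 * C * (1 + R ^ 2)) * L := by
      have h1 := mul_le_mul_of_nonneg_left hvar (show 0 ≤ Q * (3 * C * (1 + R ^ 2)) by positivity)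
      have h2 : Cv * Q * (3 * C * (1 + R ^ 2)) ≤ Cv * Q * (3 * C * (1 + R ^ 2)) * L :=
        le_mul_of_one_le_right (by positivity) hl
      linarith
    have t3 : lam n ^ 2 * γ n * ((h n)⁻¹ * Q) * (3 * C * ρ ^ 2)
        ≤ lam n * |ρ| * (3 * C * Q * C₁ * (lam n * (γ n * (h n)⁻¹) * L)) := by
      rw [← sq_abs ρ]
      have := mul_le_mul_of_nonneg_left hρ
        (show 0 ≤ lam n ^ 2 * γ n * ((h n)⁻¹ * Q) * (3 * C) * |ρ| by positivity)
      linarith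
    have t4 : lam n * ((h n)⁻¹ * Q) * (1 + R + |ρ|) * T
        ≤ Cl * B * Q * (1 + R + C₁) * CT * L := by
      have h1 : 1 + R + |ρ| ≤ (1 + R + C₁) * L := by
        have := le_mul_of_one_le_right (show 0 ≤ 1 + R by positivity) hl
        linarith
      calc lam n * ((h n)⁻¹ * Q) * (1 + R + |ρ|) * T
          ≤ (Cl * n ^ 2 * L) * ((B * n) * Q) * ((1 + R + C₁) * L) * T := by gcongr
        _ = Cl * B * Q * (1 + R + C₁) * L * (n ^ 3 * L * T) := by ring
        _ ≤ Cl * B * Q * (1 + R + C₁) * L * (T * n ^ 4) := by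
          refine mul_le_mul_of_nonneg_left ?_ (by positivity)
          calc (n : ℝ) ^ 3 * L * T ≤ (n : ℝ) ^ 3 * n * T := by gcongr
            _ = T * n ^ 4 := by ring
        _ ≤ Cl * B * Q * (1 + R + C₁) * L * CT := mul_le_mul_of_nonneg_left hTn (by positivity)
        _ = _ := by ring
    have t5 : lam n * |ρ| * (C * h n ^ 2 + 3 * C * Q * C₁ * (lam n * (γ n * (h n)⁻¹) * L) - f x)
        ≤ lam n * |ρ| * (-κ) :=
      mul_le_mul_of_nonneg_left (by linarith [hf x hx]) (by positivity)
    rw [hA]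
    linarith
  have hfin : lam n * |ρ| + γ n * (lam n * (C * (1 + R) * h n ^ 2 - |ρ| * (f x - C * h n ^ 2))
      + lam n ^ 2 * γ n * ((h n)⁻¹ * Q) * (3 * C * (1 + R ^ 2 + ρ ^ 2))
      + lam n * ((h n)⁻¹ * Q) * (1 + R + |ρ|) * T)
      ≤ lam (n - 1) * |ρ| * (1 - δ * γ n) + γ n * A * L := by
    have h1 := mul_le_mul_of_nonneg_left hexpo hγ.le
    have h2 := mul_le_mul_of_nonneg_right hcon hρ0
    linarith
  have hexp_le := exp_contraction_dichotomy (s := lam (n - 1) * |ρ|) (by positivity) hδ hγ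
    hsm5.le hA0 hn hl hD₀
  linarith [Real.exp_le_exp.2 hfin]

/-! ### Pathwise growth and regularity of the estimator -/

section Recursion

variable {Ω : Type*} {γ h : ℕ → ℝ} {K : ℝ → ℝ} {X Y : ℕ → Ω → ℝ}

/-- Once `γ Z ∈ [0, 1]`, this form exhibits the new value as a convex combination of the old value
and the new response. -/
lemma revesz_succ (r₀ : ℝ → ℝ) (n : ℕ) (x : ℝ) (ω : Ω) :
    revesz γ h K X Y r₀ (n + 1) x ω =
      revesz γ h K X Y r₀ n x ω * (1 - γ (n + 1) * scaledKernel K (h (n + 1)) x (X (n + 1) ω))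
        + γ (n + 1) * scaledKernel K (h (n + 1)) x (X (n + 1) ω) * Y (n + 1) ω := by
  rw [revesz, scaledKernel]; ring

/-- The estimator depends affinely on the initial function. -/
lemma revesz_affine (r₀ : ℝ → ℝ) (n : ℕ) (x : ℝ) (ω : Ω) :
    revesz γ h K X Y r₀ n x ω = revesz γ h K X Y (fun _ => 0) n x ω +
      (revesz γ h K X Y (fun _ => 1) n x ω - revesz γ h K X Y (fun _ => 0) n x ω) * r₀ x := by
  induction n with
  | zero => simp [revesz]
  | succ n ih =>
    rw [revesz_succ r₀, ih, revesz_succ (fun _ => 0), revesz_succ (fun _ => 1)]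
    ring

/-- The responses up to time `n` stay below the logarithmic envelope `M + c ln k`. -/
def ResponseBound (Y : ℕ → Ω → ℝ) (M c : ℝ) (n : ℕ) : Set Ω :=
  {ω | ∀ k, 1 ≤ k → k ≤ n → |Y k ω| ≤ M + c * Real.log k}

lemma ResponseBound.anti {M c : ℝ} {m n : ℕ} (hmn : m ≤ n) :
    ResponseBound Y M c n ⊆ ResponseBound Y M c m := fun _ hω k hk hkm => hω k hk (hkm.trans hmn)

lemma mem_responseBound_succ {M c : ℝ} {n : ℕ} {ω : Ω} :
    ω ∈ ResponseBound Y M c (n + 1) ↔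
      ω ∈ ResponseBound Y M c n ∧ |Y (n + 1) ω| ≤ M + c * Real.log ((n + 1 : ℕ) : ℝ) := by
  constructor
  · exact fun hω => ⟨ResponseBound.anti n.le_succ hω, hω _ (by omega) le_rfl⟩
  · rintro ⟨h1, h2⟩ k hk hkn
    rcases Nat.lt_or_ge k (n + 1) with h3 | h3
    · exact h1 k hk (by omega)
    · obtain rfl : k = n + 1 := by omega
      exact h2

/-- A crude bound at a fixed time, when `γ Z` may still exceed `1`. It starts the asymptotic
inductions and gives finiteness of the suprema. -/
lemma revesz_bound_finite {Q : ℝ} (hK0 : ∀ z, 0 ≤ K z) (hQ : ∀ z, K z ≤ Q) (M c : ℝ)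
    (r₀ : ℝ → ℝ) {I : Set ℝ} (hr₀ : ∃ C, ∀ x ∈ I, |r₀ x| ≤ C) (n : ℕ) :
    ∃ B, 0 ≤ B ∧ ∀ x ∈ I, ∀ ω ∈ ResponseBound Y M c n, |revesz γ h K X Y r₀ n x ω| ≤ B := by
  induction n with
  | zero =>
    obtain ⟨C, hC⟩ := hr₀
    exact ⟨|C|, abs_nonneg _, fun x hx ω _ => (hC x hx).trans (le_abs_self C)⟩
  | succ n ih =>
    obtain ⟨B, hB0, hB⟩ := ih
    set G := |γ (n + 1)| * (|(h (n + 1))⁻¹| * Q) with hG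
    have hQ0 : 0 ≤ Q := (hK0 0).trans (hQ 0)
    have hG0 : 0 ≤ G := by positivity
    set T := |M + c * Real.log ((n + 1 : ℕ) : ℝ)|
    refine ⟨B * (1 + G) + G * T, by positivity, fun x hx ω hω => ?_⟩
    obtain ⟨h1, h2⟩ := mem_responseBound_succ.1 hω
    have h3 : |γ (n + 1) * scaledKernel K (h (n + 1)) x (X (n + 1) ω)| ≤ G := by
      rw [abs_mul, scaledKernel, abs_mul, abs_of_nonneg (hK0 _)]
      exact mul_le_mul_of_nonneg_left (mul_le_mul_of_nonneg_left (hQ _) (abs_nonneg _))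
        (abs_nonneg _)
    rw [revesz_succ]
    refine (abs_add_le _ _).trans (add_le_add ?_ ?_)
    · rw [abs_mul]
      refine mul_le_mul (hB x hx ω h1) ((abs_sub _ _).trans ?_) (abs_nonneg _) hB0
      rw [abs_one]; linarith
    · rw [abs_mul]
      exact mul_le_mul h3 (h2.trans (le_abs_self _)) (abs_nonneg _) hG0

lemma revesz_lipschitz_finite {Q L : ℝ} (hK0 : ∀ z, 0 ≤ K z) (hQ : ∀ z, K z ≤ Q) (hL0 : 0 ≤ L)
    (hL : ∀ z w, |K z - K w| ≤ L * |z - w|) (M c c₀ : ℝ) (n : ℕ) :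
    ∃ B, 0 ≤ B ∧ ∀ x y, ∀ ω ∈ ResponseBound Y M c n,
      |revesz γ h K X Y (fun _ => c₀) n x ω - revesz γ h K X Y (fun _ => c₀) n y ω|
        ≤ B * |x - y| := by
  induction n with
  | zero => exact ⟨0, le_rfl, fun x y ω _ => by simp [revesz]⟩
  | succ n ih =>
    obtain ⟨B, hB0, hB⟩ := ih
    obtain ⟨D, hD0, hD⟩ := revesz_bound_finite (γ := γ) (h := h) (X := X) (Y := Y) (I := Set.univ)
      hK0 hQ M c (fun _ => c₀) ⟨|c₀|, fun x _ => le_rfl⟩ n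
    set G := |γ (n + 1)| * (|(h (n + 1))⁻¹| * Q) with hG
    set E := |γ (n + 1)| * (|(h (n + 1))⁻¹| * (L * |(h (n + 1))⁻¹|)) with hE
    have hQ0 : 0 ≤ Q := (hK0 0).trans (hQ 0)
    have hG0 : 0 ≤ G := by positivity
    set T := |M + c * Real.log ((n + 1 : ℕ) : ℝ)|
    refine ⟨B * (1 + G) + E * (T + D), by positivity, fun x y ω hω => ?_⟩
    obtain ⟨h1, h2⟩ := mem_responseBound_succ.1 hω
    set a := γ (n + 1) * scaledKernel K (h (n + 1)) x (X (n + 1) ω) with ha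
    set b := γ (n + 1) * scaledKernel K (h (n + 1)) y (X (n + 1) ω) with hb
    have h3 : |a| ≤ G := by
      rw [ha, abs_mul, scaledKernel, abs_mul, abs_of_nonneg (hK0 _)]
      exact mul_le_mul_of_nonneg_left (mul_le_mul_of_nonneg_left (hQ _) (abs_nonneg _))
        (abs_nonneg _)
    have h4 : |a - b| ≤ E * |x - y| := by
      have e : a - b = γ (n + 1) * ((h (n + 1))⁻¹ * (K ((h (n + 1))⁻¹ * (x - X (n + 1) ω))
          - K ((h (n + 1))⁻¹ * (y - X (n + 1) ω)))) := by
        rw [ha, hb, scaledKernel, scaledKernel]; ring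
      have h5 := hL ((h (n + 1))⁻¹ * (x - X (n + 1) ω)) ((h (n + 1))⁻¹ * (y - X (n + 1) ω))
      rw [← mul_sub, sub_sub_sub_cancel_right, abs_mul] at h5
      rw [e, abs_mul, abs_mul, hE]
      calc _ ≤ |γ (n + 1)| * (|(h (n + 1))⁻¹| * (L * (|(h (n + 1))⁻¹| * |x - y|))) := by gcongr
        _ = _ := by ring
    rw [revesz_succ, revesz_succ, ← ha, ← hb]
    set u := revesz γ h K X Y (fun _ => c₀) n x ω
    set v := revesz γ h K X Y (fun _ => c₀) n y ω
    have e : u * (1 - a) + a * Y (n + 1) ω - (v * (1 - b) + b * Y (n + 1) ω)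
        = (u - v) * (1 - a) + (a - b) * (Y (n + 1) ω - v) := by ring
    rw [e]
    have h6 : |1 - a| ≤ 1 + G := (abs_sub _ _).trans (by rw [abs_one]; linarith)
    have h7 : |Y (n + 1) ω - v| ≤ T + D :=
      (abs_sub _ _).trans (add_le_add (h2.trans (le_abs_self _)) (hD y trivial ω h1))
    have h8 := mul_le_mul (hB x y ω h1) h6 (abs_nonneg _) (by positivity)
    have h9 := mul_le_mul h4 h7 (abs_nonneg _) (by positivity)
    calc _ ≤ |(u - v)| * |1 - a| + |a - b| * |Y (n + 1) ω - v| := by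
          rw [← abs_mul, ← abs_mul]; exact abs_add_le _ _
      _ ≤ _ := by linarith

variable {lam : ℕ → ℝ} {φ : ℝ}

lemma RateConditions.eventually_step_mem (H : RateConditions γ h lam φ) {Q : ℝ}
    (hK0 : ∀ z, 0 ≤ K z) (hQ : ∀ z, K z ≤ Q) :
    ∀ᶠ n : ℕ in atTop, ∀ x s, γ n * scaledKernel K (h n) x s ∈ Set.Icc (0 : ℝ) 1 := by
  have h1 : ∀ᶠ n : ℕ in atTop, Q * (γ n * (h n)⁻¹) < 1 :=
    (H.ratio_tendsto_zero.const_mul _).eventually_lt_const (by rw [mul_zero]; exact one_pos)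
  filter_upwards [h1, eventually_ge_atTop 1] with n h1 hn x s
  have hγ := H.step_pos n hn
  have hh := H.band_pos n hn
  refine ⟨mul_nonneg hγ.le (scaledKernel_nonneg hK0 hh x s), ?_⟩
  have := mul_le_mul_of_nonneg_left (scaledKernel_le hQ hh x s) hγ.le
  linarith

/-- Logarithmic growth of the estimator while the responses are below the envelope. -/
lemma revesz_log_bound (H : RateConditions γ h lam φ) {Q : ℝ} (hK0 : ∀ z, 0 ≤ K z)
    (hQ : ∀ z, K z ≤ Q) {M c : ℝ} (hM : 0 ≤ M) (hc : 0 ≤ c) (c₀ : ℝ) :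
    ∃ C, 0 ≤ C ∧ ∀ᶠ n : ℕ in atTop, ∀ x, ∀ ω ∈ ResponseBound Y M c n,
      |revesz γ h K X Y (fun _ => c₀) n x ω| ≤ C * Real.log n := by
  obtain ⟨N, hN⟩ := eventually_atTop.1 (H.eventually_step_mem hK0 hQ)
  obtain ⟨B, hB0, hB⟩ := revesz_bound_finite (γ := γ) (h := h) (X := X) (Y := Y) (I := Set.univ)
      hK0 hQ M c (fun _ => c₀) ⟨|c₀|, fun x _ => le_rfl⟩ N
  refine ⟨B + M + c, by positivity, ?_⟩
  -- From `N` on, convexity keeps the estimator below the larger of its past bound and the response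
  -- envelope.
  have key : ∀ n, N ≤ n → ∀ x, ∀ ω ∈ ResponseBound Y M c n,
      |revesz γ h K X Y (fun _ => c₀) n x ω| ≤ B + M + c * Real.log n := by
    intro n hn
    induction n, hn using Nat.le_induction with
    | base =>
      intro x ω hω
      have := mul_nonneg hc (Real.log_natCast_nonneg N)
      linarith [hB x trivial ω hω]
    | succ n hn ih =>
      intro x ω hω
      obtain ⟨h1, h2⟩ := mem_responseBound_succ.1 hω
      obtain ⟨h3, h4⟩ := hN (n + 1) (by omega) x (X (n + 1) ω)
      rw [revesz_succ]
      set a := γ (n + 1) * scaledKernel K (h (n + 1)) x (X (n + 1) ω)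
      have h5 := ih x ω h1
      have h6 : c * Real.log n ≤ c * Real.log ((n + 1 : ℕ) : ℝ) := by
        refine mul_le_mul_of_nonneg_left ?_ hc
        rcases Nat.eq_zero_or_pos n with rfl | hp
        · simp
        · exact Real.log_le_log (by positivity) (by push_cast; linarith)
      refine (abs_add_le _ _).trans ?_
      rw [abs_mul, abs_mul, abs_of_nonneg h3, abs_of_nonneg (sub_nonneg.2 h4)]
      have h7 := mul_le_mul_of_nonneg_right (h5.trans (show _ ≤ B + M + c * Real.log ((n + 1 : ℕ) : ℝ)
        by linarith)) (sub_nonneg.2 h4)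
      have h8 := mul_le_mul_of_nonneg_left (h2.trans (show _ ≤ B + M + c * Real.log ((n + 1 : ℕ) : ℝ)
        by linarith)) h3
      linarith
  filter_upwards [eventually_ge_atTop N, RateConditions.eventually_one_le_log] with n hn hl x ω hω
  have := key n hn x ω hω
  have h1 := le_mul_of_one_le_right (show 0 ≤ B + M by positivity) hl
  linarith

/-- Polynomial growth of the Lipschitz constant of the estimator. -/
lemma revesz_lipschitz_bound (H : RateConditions γ h lam φ) {Q L : ℝ} (hK0 : ∀ z, 0 ≤ K z)
    (hQ : ∀ z, K z ≤ Q) (hL0 : 0 ≤ L) (hL : ∀ z w, |K z - K w| ≤ L * |z - w|)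
    {M c : ℝ} (hM : 0 ≤ M) (hc : 0 ≤ c) (c₀ : ℝ) :
    ∃ C, 0 ≤ C ∧ ∀ᶠ n : ℕ in atTop, ∀ x y, ∀ ω ∈ ResponseBound Y M c n,
      |revesz γ h K X Y (fun _ => c₀) n x ω - revesz γ h K X Y (fun _ => c₀) n y ω|
        ≤ C * n ^ 4 * |x - y| := by
  obtain ⟨C₁, hC₁, hb⟩ := revesz_log_bound (X := X) (Y := Y) H hK0 hQ hM hc c₀
  obtain ⟨Ch, hCh, hh⟩ := H.band_inv_le
  have hs5 : ∀ᶠ n : ℕ in atTop, γ n < 1 := H.step_tendsto.eventually_lt_const one_pos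
  obtain ⟨N, hN⟩ := eventually_atTop.1 ((H.eventually_step_mem hK0 hQ).and
    (hb.and (hs5.and RateConditions.eventually_one_le_log)))
  obtain ⟨B, hB0, hB⟩ := revesz_lipschitz_finite (γ := γ) (h := h) (X := X) (Y := Y)
      hK0 hQ hL0 hL M c c₀ N
  set G := L * Ch ^ 2 * (M + c + C₁) with hG
  have hG0 : 0 ≤ G := by positivity
  refine ⟨B + G, by positivity, ?_⟩
  have key : ∀ n, N ≤ n → ∀ x y, ∀ ω ∈ ResponseBound Y M c n,
      |revesz γ h K X Y (fun _ => c₀) n x ω - revesz γ h K X Y (fun _ => c₀) n y ω|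
        ≤ (B + G * n ^ 4) * |x - y| := by
    intro n hn
    induction n, hn using Nat.le_induction with
    | base =>
      intro x y ω hω
      refine (hB x y ω hω).trans (mul_le_mul_of_nonneg_right ?_ (abs_nonneg _))
      have : 0 ≤ G * (N : ℝ) ^ 4 := by positivity
      linarith
    | succ n hn ih =>
      intro x y ω hω
      obtain ⟨h1, h2⟩ := mem_responseBound_succ.1 hω
      obtain ⟨hmem, -, hγ1, hl⟩ := hN (n + 1) (by omega)
      obtain ⟨h3, h4⟩ := hmem x (X (n + 1) ω)
      obtain ⟨-, hbn, -, hln⟩ := hN n hn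
      have hγ := H.step_pos (n + 1) (by omega)
      have hp := H.band_pos (n + 1) (by omega)
      have hhn := hh (n + 1) (by omega)
      set w : ℝ := ((n + 1 : ℕ) : ℝ) with hw
      have hw0 : 0 < w := by positivity
      have hlw : Real.log w ≤ w := (Real.log_le_sub_one_of_pos hw0).trans (by linarith)
      have hnw : (n : ℝ) = w - 1 := by rw [hw]; push_cast; ring
      set a := γ (n + 1) * scaledKernel K (h (n + 1)) x (X (n + 1) ω) with ha
      set b := γ (n + 1) * scaledKernel K (h (n + 1)) y (X (n + 1) ω) with hb
      have h5 : |a - b| ≤ L * (Ch * w) ^ 2 * |x - y| := by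
        have e : a - b = γ (n + 1) * ((h (n + 1))⁻¹ * (K ((h (n + 1))⁻¹ * (x - X (n + 1) ω))
            - K ((h (n + 1))⁻¹ * (y - X (n + 1) ω)))) := by
          rw [ha, hb, scaledKernel, scaledKernel]; ring
        have h5 := hL ((h (n + 1))⁻¹ * (x - X (n + 1) ω)) ((h (n + 1))⁻¹ * (y - X (n + 1) ω))
        rw [← mul_sub, sub_sub_sub_cancel_right, abs_mul, abs_of_pos (inv_pos.2 hp)] at h5
        rw [e, abs_mul, abs_mul, abs_of_pos hγ, abs_of_pos (inv_pos.2 hp)]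
        calc _ ≤ 1 * ((Ch * w) * (L * ((Ch * w) * |x - y|))) := by
              have : 0 < (h (n + 1))⁻¹ := inv_pos.2 hp
              refine mul_le_mul hγ1.le (mul_le_mul hhn (h5.trans ?_) (abs_nonneg _) (by positivity))
                (by positivity) zero_le_one
              gcongr
          _ = _ := by ring
      rw [revesz_succ, revesz_succ, ← ha, ← hb]
      have hvb := hbn y ω h1
      have hih := ih x y ω h1
      set u := revesz γ h K X Y (fun _ => c₀) n x ω
      set v := revesz γ h K X Y (fun _ => c₀) n y ω
      have e : u * (1 - a) + a * Y (n + 1) ω - (v * (1 - b) + b * Y (n + 1) ω)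
          = (u - v) * (1 - a) + (a - b) * (Y (n + 1) ω - v) := by ring
      have h7 : |Y (n + 1) ω - v| ≤ (M + c + C₁) * w := by
        have hM' := le_mul_of_one_le_right hM (hl.trans hlw)
        have hc' := mul_le_mul_of_nonneg_left hlw hc
        have hlog : Real.log n ≤ w :=
          ((Real.log_le_sub_one_of_pos (by
            by_contra h0
            have : (n : ℝ) = 0 := le_antisymm (not_lt.1 h0) (Nat.cast_nonneg n)
            rw [this, Real.log_zero] at hln
            linarith)).trans (by linarith))
        have hC' := mul_le_mul_of_nonneg_left hlog hC₁
        refine (abs_sub _ _).trans ?_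
        linarith
      rw [e]
      have h6 : |1 - a| ≤ 1 := by rw [abs_of_nonneg (sub_nonneg.2 h4)]; linarith
      have h8 := mul_le_mul hih h6 (abs_nonneg _) ((abs_nonneg _).trans hih)
      have h9 := mul_le_mul h5 h7 (abs_nonneg _) (by positivity)
      -- The new increment is `w²` from the rescaled kernel times `w` from `|Y - v|`. With `w = n +
      -- 1`, `n⁴ + w³ ≤ w⁴` closes the induction, whence the exponent `4`.
      have h10 : G * (n : ℝ) ^ 4 + G * w ^ 3 ≤ G * w ^ 4 := by
        rw [← mul_add]
        refine mul_le_mul_of_nonneg_left ?_ hG0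
        have : (n : ℝ) ^ 4 ≤ n * w ^ 3 := by
          calc (n : ℝ) ^ 4 = n * (n : ℝ) ^ 3 := by ring
            _ ≤ n * w ^ 3 := by gcongr; linarith
        calc (n : ℝ) ^ 4 + w ^ 3 ≤ n * w ^ 3 + w ^ 3 := by linarith
          _ = w ^ 4 := by rw [hnw]; ring
      calc _ ≤ |(u - v)| * |1 - a| + |a - b| * |Y (n + 1) ω - v| := by
            rw [← abs_mul, ← abs_mul]; exact abs_add_le _ _
        _ ≤ (B + (G * (n : ℝ) ^ 4 + G * w ^ 3)) * |x - y| := by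
            refine (add_le_add h8 h9).trans (le_of_eq ?_)
            rw [hG]; ring
        _ ≤ _ := mul_le_mul_of_nonneg_right (by linarith) (abs_nonneg _)
  filter_upwards [eventually_ge_atTop N, eventually_ge_atTop 1] with n hn hn1 x y ω hω
  refine (key n hn x y ω hω).trans (mul_le_mul_of_nonneg_right ?_ (abs_nonneg _))
  have : (1 : ℝ) ≤ (n : ℝ) ^ 4 := one_le_pow₀ (by exact_mod_cast hn1)
  have := le_mul_of_one_le_right hB0 this
  linarith

end Recursion

/-! ### Independence, the Lyapunov functional and the response envelope -/

lemma lintegral_comp_of_indepFun {Ω α β : Type*} [MeasurableSpace Ω] [MeasurableSpace α]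
    [MeasurableSpace β] {μ : Measure Ω} [IsProbabilityMeasure μ] {U : Ω → α} {V : Ω → β}
    (hU : Measurable U) (hV : Measurable V) (hUV : IndepFun U V μ) {G : α × β → ENNReal}
    (hG : Measurable G) :
    ∫⁻ ω, G (U ω, V ω) ∂μ = ∫⁻ ω, ∫⁻ v, G (U ω, v) ∂(μ.map V) ∂μ := by
  have h1 := (indepFun_iff_map_prod_eq_prod_map_map hU.aemeasurable hV.aemeasurable).1 hUV
  have : IsProbabilityMeasure (μ.map V) := Measure.isProbabilityMeasure_map hV.aemeasurable
  rw [← lintegral_map (f := G) hG (hU.prodMk hV), h1, lintegral_prod _ hG.aemeasurable,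
    lintegral_map hG.lintegral_prod_right' hU]

section Sample

variable {Ω : Type*} [MeasurableSpace Ω] {μ : Measure Ω}
  {X Y : ℕ → Ω → ℝ} {g : ℝ → ℝ → ℝ} {γ h : ℕ → ℝ} {K : ℝ → ℝ}

namespace IsIIDSample

lemma measurable_pair (S : IsIIDSample μ X Y g) (n : ℕ) : Measurable fun ω => (X n ω, Y n ω) :=
  (S.measurable_X n).prodMk (S.measurable_Y n)

/-- The natural filtration of the sample. -/
def filtration (S : IsIIDSample μ X Y g) : Filtration ℕ ‹MeasurableSpace Ω› :=
  Filtration.natural (fun n ω => (X n ω, Y n ω)) fun n => (S.measurable_pair n).stronglyMeasurable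

lemma measurable_pair_filtration (S : IsIIDSample μ X Y g) {k n : ℕ} (hk : k ≤ n) :
    Measurable[S.filtration n] fun ω => (X k ω, Y k ω) :=
  ((Filtration.stronglyAdapted_natural fun n =>
    (S.measurable_pair n).stronglyMeasurable) k).measurable.mono (S.filtration.mono hk) le_rfl

lemma measurable_revesz (S : IsIIDSample μ X Y g) (hK : Measurable K) (c₀ x : ℝ) (n : ℕ) :
    Measurable[S.filtration n] (revesz γ h K X Y (fun _ => c₀) n x) := by
  induction n with
  | zero => exact measurable_const
  | succ n ih =>
    have h1 := ih.mono (S.filtration.mono n.le_succ) le_rfl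
    have h2 := S.measurable_pair_filtration (le_refl (n + 1))
    have hX : Measurable[S.filtration (n + 1)] (X (n + 1)) := measurable_fst.comp h2
    have hY : Measurable[S.filtration (n + 1)] (Y (n + 1)) := measurable_snd.comp h2
    have hZ : Measurable[S.filtration (n + 1)]
        fun ω => scaledKernel K (h (n + 1)) x (X (n + 1) ω) := by
      unfold scaledKernel
      exact (hK.comp ((hX.const_sub x).const_mul _)).const_mul _
    have : revesz γ h K X Y (fun _ => c₀) (n + 1) x = fun ω =>
      revesz γ h K X Y (fun _ => c₀) n x ω * (1 - γ (n + 1) *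
        scaledKernel K (h (n + 1)) x (X (n + 1) ω))
        + γ (n + 1) * scaledKernel K (h (n + 1)) x (X (n + 1) ω) * Y (n + 1) ω :=
      funext fun ω => revesz_succ _ n x ω
    rw [this]
    exact (h1.mul ((hZ.const_mul _).const_sub 1)).add ((hZ.const_mul _).mul hY)

lemma measurableSet_responseBound (S : IsIIDSample μ X Y g) (M c : ℝ) (n : ℕ) :
    MeasurableSet[S.filtration n] (ResponseBound Y M c n) := by
  have : ResponseBound Y M c n = ⋂ k ∈ Finset.Icc 1 n, {ω | |Y k ω| ≤ M + c * Real.log k} := by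
    ext ω
    simp [ResponseBound]
  rw [this]
  refine Finset.measurableSet_biInter _ fun k hk => ?_
  have hY : Measurable[S.filtration n] (Y k) :=
    measurable_snd.comp (S.measurable_pair_filtration (Finset.mem_Icc.1 hk).2)
  exact measurableSet_le (measurable_norm.comp hY) measurable_const

lemma indepFun_of_measurable_filtration (S : IsIIDSample μ X Y g) {α : Type*} [MeasurableSpace α]
    {U : Ω → α} {n : ℕ} (hU : Measurable[S.filtration n] U) :
    IndepFun U (fun ω => (X (n + 1) ω, Y (n + 1) ω)) μ := by
  rw [IndepFun_iff_Indep]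
  exact (indep_of_indep_of_le_right (S.indep.indep_comap_natural_of_lt
    (fun n => (S.measurable_pair n).stronglyMeasurable) n.lt_succ_self) hU.comap_le).symm

lemma isProbabilityMeasure_densityLaw [IsProbabilityMeasure μ] (S : IsIIDSample μ X Y g) :
    IsProbabilityMeasure (densityLaw g) := by
  rw [densityLaw, ← S.law 0]
  exact Measure.isProbabilityMeasure_map (S.measurable_pair 0).aemeasurable

end IsIIDSample

/-- The exponential Lyapunov functional of the error at `x`, on the event that the responses stay
below the envelope. -/
def lyapunov (μ : Measure Ω) (γ h lam : ℕ → ℝ) (K : ℝ → ℝ) (X Y : ℕ → Ω → ℝ) (c₀ θ M c : ℝ)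
    (n : ℕ) (x : ℝ) : ENNReal :=
  ∫⁻ ω, (ResponseBound Y M c n).indicator (fun ω => ENNReal.ofReal (Real.exp (lam n *
    |revesz γ h K X Y (fun _ => c₀) n x ω - θ|))) ω ∂μ

variable {lam : ℕ → ℝ} {φ : ℝ}

/-- The error at time `n` and the past envelope event depend only on the first `n` pairs, while the
next pair is independent of them with law `densityLaw g`. Integrating that pair first, with the
error frozen, reduces the recursion to the deterministic-error estimate `hstep`. -/
lemma lyapunov_succ_le [IsProbabilityMeasure μ] (S : IsIIDSample μ X Y g)
    (hK : Measurable K) {c₀ θ M c x C : ℝ} {n : ℕ}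
    (hbound : ∀ ω ∈ ResponseBound Y M c n,
      |revesz γ h K X Y (fun _ => c₀) n x ω - θ| ≤ C)
    {E : ENNReal}
    (hstep : ∀ ρ : ℝ, |ρ| ≤ C →
      ∫⁻ p, {p : ℝ × ℝ | |p.2| ≤ M + c * Real.log ((n + 1 : ℕ) : ℝ)}.indicator (fun p =>
        ENNReal.ofReal (Real.exp (lam (n + 1) *
        |ρ * (1 - γ (n + 1) * scaledKernel K (h (n + 1)) x p.1)
          + γ (n + 1) * scaledKernel K (h (n + 1)) x p.1 * (p.2 - θ)|))) p ∂(densityLaw g)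
      ≤ ENNReal.ofReal (Real.exp (lam n * |ρ|)) + E) :
    lyapunov μ γ h lam K X Y c₀ θ M c (n + 1) x
      ≤ lyapunov μ γ h lam K X Y c₀ θ M c n x + E := by
  set A := ResponseBound Y M c n with hA
  have hAF := S.measurableSet_responseBound M c n
  have hAm : MeasurableSet A := S.filtration.le n _ hAF
  set B := {p : ℝ × ℝ | |p.2| ≤ M + c * Real.log ((n + 1 : ℕ) : ℝ)} with hB
  have hBm : MeasurableSet B := measurableSet_le (by fun_prop) measurable_const
  -- The indicator of the past event is carried as a coordinate, so that it is frozen together with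
  -- the error.
  set U : Ω → ENNReal × ℝ := fun ω => (A.indicator 1 ω,
    revesz γ h K X Y (fun _ => c₀) n x ω - θ) with hU
  have hUF : Measurable[S.filtration n] U := by
    refine Measurable.prodMk ?_ ((S.measurable_revesz hK c₀ x n).sub_const θ)
    have h1 : Measurable[S.filtration n] (1 : Ω → ENNReal) := measurable_const
    exact h1.indicator hAF
  set G : (ENNReal × ℝ) × (ℝ × ℝ) → ENNReal := fun q => q.1.1 * B.indicator (fun p =>
        ENNReal.ofReal (Real.exp (lam (n + 1) *
        |q.1.2 * (1 - γ (n + 1) * scaledKernel K (h (n + 1)) x p.1)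
          + γ (n + 1) * scaledKernel K (h (n + 1)) x p.1 * (p.2 - θ)|))) q.2 with hG
  have hZm : Measurable (scaledKernel K (h (n + 1)) x) := by
    unfold scaledKernel
    fun_prop
  have hGm : Measurable G := by
    refine measurable_fst.fst.mul ?_
    have : (fun q : (ENNReal × ℝ) × (ℝ × ℝ) => B.indicator (fun p =>
        ENNReal.ofReal (Real.exp (lam (n + 1) *
        |q.1.2 * (1 - γ (n + 1) * scaledKernel K (h (n + 1)) x p.1)
          + γ (n + 1) * scaledKernel K (h (n + 1)) x p.1 * (p.2 - θ)|))) q.2)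
        = (Prod.snd ⁻¹' B).indicator (fun q : (ENNReal × ℝ) × (ℝ × ℝ) =>
        ENNReal.ofReal (Real.exp (lam (n + 1) *
        |q.1.2 * (1 - γ (n + 1) * scaledKernel K (h (n + 1)) x q.2.1)
          + γ (n + 1) * scaledKernel K (h (n + 1)) x q.2.1 * (q.2.2 - θ)|))) := by
      ext q
      simp only [Set.indicator, Set.mem_preimage]
    rw [this]
    exact Measurable.indicator (by fun_prop) (measurable_snd hBm)
  have hUm : Measurable U := hUF.mono (S.filtration.le n) le_rfl
  have hkey := lintegral_comp_of_indepFun hUm (S.measurable_pair (n + 1))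
    (S.indepFun_of_measurable_filtration hUF) hGm
  have hlaw : μ.map (fun ω => (X (n + 1) ω, Y (n + 1) ω)) = densityLaw g := S.law (n + 1)
  rw [hlaw] at hkey
  have hL : lyapunov μ γ h lam K X Y c₀ θ M c (n + 1) x
      = ∫⁻ ω, G (U ω, (X (n + 1) ω, Y (n + 1) ω)) ∂μ := by
    refine lintegral_congr fun ω => ?_
    simp only [hG, hU]
    by_cases h1 : ω ∈ A
    · rw [Set.indicator_of_mem h1, Pi.one_apply, one_mul]
      by_cases h2 : (X (n + 1) ω, Y (n + 1) ω) ∈ B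
      · rw [Set.indicator_of_mem (mem_responseBound_succ.2 ⟨h1, h2⟩), Set.indicator_of_mem h2,
          revesz_succ]
        congr 4
        ring
      · rw [Set.indicator_of_notMem (fun h3 => h2 (mem_responseBound_succ.1 h3).2),
          Set.indicator_of_notMem h2]
    · rw [Set.indicator_of_notMem (fun h3 => h1 (mem_responseBound_succ.1 h3).1),
        Set.indicator_of_notMem h1, zero_mul]
  rw [hL, hkey]
  calc ∫⁻ ω, ∫⁻ v, G (U ω, v) ∂(densityLaw g) ∂μ
      ≤ ∫⁻ ω, (A.indicator (fun ω => ENNReal.ofReal (Real.exp (lam n *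
          |revesz γ h K X Y (fun _ => c₀) n x ω - θ|))) ω + E) ∂μ := by
        refine lintegral_mono fun ω => ?_
        by_cases h1 : ω ∈ A
        · simp only [hG, hU]
          rw [Set.indicator_of_mem h1, Set.indicator_of_mem h1]
          simp only [Pi.one_apply, one_mul]
          exact hstep _ (hbound ω h1)
        · simp only [hG, hU]
          rw [Set.indicator_of_notMem h1]
          simp
    _ = _ := by
        rw [lintegral_add_right _ measurable_const]
        simp [lyapunov, hA]

/-- The responses a.s. stay below a logarithmic envelope. -/
lemma ae_exists_responseBound (S : IsIIDSample μ X Y g) {t : ℝ} (ht : 0 < t)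
    (hexp : Integrable (fun p : ℝ × ℝ => Real.exp (t * |p.2|)) (densityLaw g)) :
    ∀ᵐ ω ∂μ, ∃ M : ℕ, ∀ n, ω ∈ ResponseBound Y M (8 / t) n := by
  set E := ∫⁻ p, ENNReal.ofReal (Real.exp (t * |p.2|)) ∂(densityLaw g) with hE
  have hEfin : E ≠ ⊤ := by
    have := hexp.lintegral_lt_top
    exact this.ne
  -- Index `0` is emptied because the bound sought there, with `1 / 0 = 0`, is zero.
  set B : ℕ → Set Ω := fun k => if k = 0 then ∅ else {ω | 8 / t * Real.log k < |Y k ω|} with hB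
  have hbound : ∀ k, μ (B k) ≤ E * ENNReal.ofReal (1 / (k : ℝ) ^ 8) := by
    intro k
    rcases Nat.eq_zero_or_pos k with rfl | hk
    · simp [hB]
    have hk0 : (0 : ℝ) < k := by positivity
    have hk8 : (0 : ℝ) < (k : ℝ) ^ 8 := by positivity
    have hm : Measurable fun p : ℝ × ℝ => ENNReal.ofReal (Real.exp (t * |p.2|)) := by fun_prop
    have h1 : E = ∫⁻ ω, ENNReal.ofReal (Real.exp (t * |Y k ω|)) ∂μ := by
      rw [hE, densityLaw, ← S.law k, lintegral_map hm (S.measurable_pair k)]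
    have hmk : Measurable fun ω => ENNReal.ofReal (Real.exp (t * |Y k ω|)) :=
      hm.comp (S.measurable_pair k)
    have h2 := mul_meas_ge_le_lintegral (μ := μ) hmk (ENNReal.ofReal ((k : ℝ) ^ 8))
    rw [← h1] at h2
    have h3 : B k ⊆ {ω | ENNReal.ofReal ((k : ℝ) ^ 8) ≤ ENNReal.ofReal (Real.exp (t * |Y k ω|))} := by
      intro ω hω
      simp only [hB, hk.ne', if_false, Set.mem_ofPred_eq] at hω ⊢
      refine ENNReal.ofReal_le_ofReal ?_
      have h4 : (k : ℝ) ^ 8 = Real.exp ((8 : ℕ) * Real.log k) := by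
        rw [Real.exp_nat_mul, Real.exp_log hk0]
      rw [h4]
      refine Real.exp_le_exp.2 ?_
      have h5 := mul_le_mul_of_nonneg_left hω.le ht.le
      have h6 : t * (8 / t * Real.log k) = 8 * Real.log k := by field_simp
      push_cast
      linarith
    have h4 : ENNReal.ofReal ((k : ℝ) ^ 8) * μ (B k) ≤ E :=
      (mul_le_mul_right (measure_mono h3) _).trans h2
    rw [one_div, ENNReal.ofReal_inv_of_pos hk8, ← div_eq_mul_inv]
    rw [ENNReal.le_div_iff_mul_le (Or.inl (ENNReal.ofReal_pos.2 hk8).ne') (Or.inl ENNReal.ofReal_ne_top)]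
    rwa [mul_comm]
  have hsum : ∑' k, μ (B k) ≠ ⊤ := by
    refine ne_top_of_le_ne_top ?_ (ENNReal.tsum_le_tsum hbound)
    rw [ENNReal.tsum_mul_left]
    refine ENNReal.mul_ne_top hEfin ?_
    have hs : Summable fun k : ℕ => 1 / (k : ℝ) ^ 8 := Real.summable_one_div_nat_pow.2 (by norm_num)
    rw [← ENNReal.ofReal_tsum_of_nonneg (fun k => by positivity) hs]
    exact ENNReal.ofReal_ne_top
  filter_upwards [ae_eventually_notMem hsum] with ω hω
  obtain ⟨N, hN⟩ := eventually_atTop.1 hω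
  -- Only finitely many responses exceed the logarithmic term, and `M` absorbs them. A natural `M`
  -- keeps the later union of exceptional sets countable.
  obtain ⟨M, hM⟩ := exists_nat_ge (∑ k ∈ Finset.range N, |Y k ω|)
  refine ⟨M, fun n k hk _ => ?_⟩
  have hlog : 0 ≤ 8 / t * Real.log k := mul_nonneg (by positivity) (Real.log_natCast_nonneg k)
  rcases lt_or_ge k N with h1 | h1
  · have := Finset.single_le_sum (f := fun k => |Y k ω|) (fun k _ => abs_nonneg _)
      (Finset.mem_range.2 h1)
    linarith
  · have h2 := hN k h1
    simp only [hB, show k ≠ 0 by omega, if_false, Set.mem_ofPred_eq, not_lt] at h2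
    have : (0 : ℝ) ≤ M := Nat.cast_nonneg M
    linarith

end Sample

/-! ### Polynomial Lyapunov growth and the uniform rate -/

section Rate

variable {Ω : Type*} [MeasurableSpace Ω] {μ : Measure Ω} [IsProbabilityMeasure μ]
  {X Y : ℕ → Ω → ℝ} {g : ℝ → ℝ → ℝ} {γ h lam : ℕ → ℝ} {K : ℝ → ℝ} {φ : ℝ}

/-- Polynomial growth of the exponential Lyapunov functional, uniformly over `I`. -/
lemma lyapunov_polynomial (S : IsIIDSample μ X Y g) (hA1 : AssumptionA1 K)
    (H : RateConditions γ h lam φ) {I : Set ℝ} {f θ : ℝ → ℝ} {C R t : ℝ} (hC : 0 ≤ C) (ht : 0 < t)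
    (hexp : Integrable (fun p : ℝ × ℝ => Real.exp (t * |p.2|)) (densityLaw g))
    (hm : ∀ x ∈ I, ∀ η, 0 < η → KernelMoments (densityLaw g) K C x (f x) (θ x) η)
    (hf : ∀ x ∈ I, φ ≤ f x) (hR : 0 ≤ R) (hθ : ∀ x ∈ I, |θ x| ≤ R) {M : ℝ} (hM : 0 ≤ M)
    (c₀ : ℝ) :
    ∃ B : ℝ, 0 ≤ B ∧ ∃ D : ℕ, ∀ᶠ n : ℕ in atTop, ∀ x ∈ I,
      lyapunov μ γ h lam K X Y c₀ (θ x) M (8 / t) n x ≤ ENNReal.ofReal (B * (n : ℝ) ^ D) := by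
  have := S.isProbabilityMeasure_densityLaw
  obtain ⟨Q, hQ⟩ := hA1.bounded
  obtain ⟨C₁, hC₁, hb⟩ := revesz_log_bound (X := X) (Y := Y) (c := 8 / t) H hA1.nonneg hQ hM
    (by positivity) c₀
  obtain ⟨D, hD⟩ := exp_error_step_eventually hA1 H hC ht hexp hm hf hθ hM
    (show 0 ≤ C₁ + R by positivity)
  obtain ⟨N, hN⟩ := eventually_atTop.1 (hD.and (hb.and (RateConditions.eventually_one_le_log.and
    (eventually_ge_atTop 1))))
  have herr : ∀ n, N ≤ n → ∀ x ∈ I, ∀ ω ∈ ResponseBound Y M (8 / t) n,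
      |revesz γ h K X Y (fun _ => c₀) n x ω - θ x| ≤ (C₁ + R) * Real.log n := by
    intro n hn x hx ω hω
    obtain ⟨-, h1, h2, -⟩ := hN n hn
    have h3 := h1 x ω hω
    have h4 := le_mul_of_one_le_right hR h2
    refine (abs_sub _ _).trans ?_
    linarith [hθ x hx]
  set B₀ := Real.exp (lam N * ((C₁ + R) * Real.log N)) with hB₀
  have hlN : 0 ≤ lam N := (H.norm_pos N (hN N le_rfl).2.2.2).le
  have key : ∀ n, N ≤ n → ∀ x ∈ I, lyapunov μ γ h lam K X Y c₀ (θ x) M (8 / t) n x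
      ≤ ENNReal.ofReal (B₀ + (n : ℝ) ^ (D + 1)) := by
    intro n hn
    induction n, hn using Nat.le_induction with
    | base =>
      intro x hx
      calc lyapunov μ γ h lam K X Y c₀ (θ x) M (8 / t) N x ≤ ∫⁻ _, ENNReal.ofReal B₀ ∂μ := by
            refine lintegral_mono fun ω => ?_
            by_cases hω : ω ∈ ResponseBound Y M (8 / t) N
            · rw [Set.indicator_of_mem hω]
              exact ENNReal.ofReal_le_ofReal (Real.exp_le_exp.2
                (mul_le_mul_of_nonneg_left (herr N le_rfl x hx ω hω) hlN))
            · rw [Set.indicator_of_notMem hω]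
              exact zero_le
        _ = ENNReal.ofReal B₀ := by simp
        _ ≤ _ := ENNReal.ofReal_le_ofReal (le_add_of_nonneg_right (by positivity))
    | succ n hn ih =>
      intro x hx
      have hlog : Real.log n ≤ Real.log ((n + 1 : ℕ) : ℝ) :=
        Real.log_le_log (by exact_mod_cast (hN n hn).2.2.2) (by push_cast; linarith)
      have hstep := (hN (n + 1) (by omega)).1 x hx
      rw [Nat.add_sub_cancel] at hstep
      refine (lyapunov_succ_le S hA1.continuous.measurable (herr n hn x hx)
        (fun ρ hρ => hstep ρ (hρ.trans
          (mul_le_mul_of_nonneg_left hlog (by positivity))))).trans ?_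
      refine (add_le_add_left (ih x hx) _).trans ?_
      rw [← ENNReal.ofReal_add (by positivity) (by positivity)]
      refine ENNReal.ofReal_le_ofReal ?_
      -- The increments `(n + 1)^D` accumulate to degree `D + 1`, through `n^(D+1) + (n+1)^D ≤
      -- (n+1)^(D+1)`.
      have h1 : (n : ℝ) ^ (D + 1) ≤ n * ((n + 1 : ℕ) : ℝ) ^ D := by
        rw [pow_succ, mul_comm]
        have : (n : ℝ) ≤ ((n + 1 : ℕ) : ℝ) := by push_cast; linarith
        gcongr
      have h2 : ((n + 1 : ℕ) : ℝ) ^ (D + 1)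
          = n * ((n + 1 : ℕ) : ℝ) ^ D + ((n + 1 : ℕ) : ℝ) ^ D := by
        push_cast; ring
      rw [h2]
      linarith
  refine ⟨B₀ + 1, by positivity, D + 1, ?_⟩
  filter_upwards [eventually_ge_atTop N] with n hn x hx
  refine (key n hn x hx).trans (ENNReal.ofReal_le_ofReal ?_)
  have h1 : (1 : ℝ) ≤ (n : ℝ) ^ (D + 1) := one_le_pow₀ (by exact_mod_cast (hN n hn).2.2.2)
  have h2 := le_mul_of_one_le_right (Real.exp_pos (lam N * ((C₁ + R) * Real.log N))).le h1
  linarith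

/-- The centres of `m` cells of equal length partitioning `(b, c)`. -/
def gridPoint (b c : ℝ) (m i : ℕ) : ℝ := b + (c - b) * ((i + 1 / 2) / m)

lemma gridPoint_mem {b c : ℝ} (hbc : b < c) {m i : ℕ} (hi : i < m) :
    gridPoint b c m i ∈ Set.Ioo b c := by
  have hm : (0 : ℝ) < m := by exact_mod_cast (Nat.zero_le i).trans_lt hi
  have hi' : (i : ℝ) + 1 ≤ m := by exact_mod_cast hi
  have h1 : 0 < ((i : ℝ) + 1 / 2) / m := by positivity
  have h2 : ((i : ℝ) + 1 / 2) / m < 1 := (div_lt_one hm).2 (by linarith)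
  have h3 : 0 < c - b := by linarith
  unfold gridPoint
  constructor <;> nlinarith

lemma exists_gridPoint_near {b c x : ℝ} (hx : x ∈ Set.Ioo b c) {m : ℕ} (hm : 0 < m) :
    ∃ i < m, |x - gridPoint b c m i| ≤ (c - b) / m := by
  have hm' : (0 : ℝ) < m := by exact_mod_cast hm
  have hcb : 0 < c - b := by linarith [hx.1, hx.2]
  set s := (x - b) / (c - b) * m with hs
  have hs0 : 0 ≤ s := mul_nonneg (div_nonneg (by linarith [hx.1]) hcb.le) hm'.le
  have hsm : s < m := by
    have : (x - b) / (c - b) < 1 := (div_lt_one hcb).2 (by linarith [hx.2])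
    nlinarith
  refine ⟨⌊s⌋₊, (Nat.floor_lt hs0).2 hsm, ?_⟩
  have h1 := Nat.floor_le hs0
  have h2 := Nat.lt_floor_add_one s
  have e : x - gridPoint b c m ⌊s⌋₊ = (c - b) / m * (s - ⌊s⌋₊ - 1 / 2) := by
    rw [gridPoint, hs]
    field_simp
    ring
  rw [e, abs_mul, abs_of_pos (by positivity)]
  exact mul_le_of_le_one_right (by positivity) (abs_le.2 ⟨by linarith, by linarith⟩)

/-- Almost sure uniform rate over the grid of `n ^ 7` points. -/
lemma ae_grid_rate (S : IsIIDSample μ X Y g) (hA1 : AssumptionA1 K)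
    (H : RateConditions γ h lam φ) {b c : ℝ} (hbc : b < c) {f θ : ℝ → ℝ} {C R t : ℝ}
    (hC : 0 ≤ C) (ht : 0 < t)
    (hexp : Integrable (fun p : ℝ × ℝ => Real.exp (t * |p.2|)) (densityLaw g))
    (hm : ∀ x ∈ Set.Ioo b c, ∀ η, 0 < η → KernelMoments (densityLaw g) K C x (f x) (θ x) η)
    (hf : ∀ x ∈ Set.Ioo b c, φ ≤ f x) (hR : 0 ≤ R) (hθ : ∀ x ∈ Set.Ioo b c, |θ x| ≤ R)
    {M : ℝ} (hM : 0 ≤ M) (c₀ : ℝ) :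
    ∃ A : ℝ, 0 ≤ A ∧ ∀ᵐ ω ∂μ, ∀ᶠ n : ℕ in atTop, ω ∈ ResponseBound Y M (8 / t) n →
      ∀ i < n ^ 7, lam n * |revesz γ h K X Y (fun _ => c₀) n (gridPoint b c (n ^ 7) i) ω
        - θ (gridPoint b c (n ^ 7) i)| ≤ A * Real.log n := by
  obtain ⟨B, hB, D, hD⟩ := lyapunov_polynomial S hA1 H hC ht hexp hm hf hR hθ hM c₀
  obtain ⟨N, hN⟩ := eventually_atTop.1 hD
  -- Markov at level `n^a` over `n^7` points leaves `n^(7 + D - a) = n⁻²`, which is summable.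
  set a := D + 9 with ha
  set err : ℕ → ℕ → Ω → ℝ := fun n i ω =>
    lam n * |revesz γ h K X Y (fun _ => c₀) n (gridPoint b c (n ^ 7) i) ω
        - θ (gridPoint b c (n ^ 7) i)| with herr
  set Bad : ℕ → ℕ → Set Ω := fun n i =>
    {ω | ω ∈ ResponseBound Y M (8 / t) n ∧ a * Real.log n < err n i ω} with hBad
  have hbad : ∀ n, N + 1 ≤ n → ∀ i < n ^ 7,
      μ (Bad n i) ≤ ENNReal.ofReal (B * (n : ℝ) ^ D / (n : ℝ) ^ a) := by
    intro n hn i hi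
    have hn0 : (0 : ℝ) < n := by exact_mod_cast (show 0 < n by omega)
    have hna : (0 : ℝ) < (n : ℝ) ^ a := by positivity
    have hAm := S.filtration.le n _ (S.measurableSet_responseBound M (8 / t) n)
    have hrm := (S.measurable_revesz (γ := γ) (h := h) hA1.continuous.measurable c₀
      (gridPoint b c (n ^ 7) i) n).mono (S.filtration.le n) le_rfl
    have hmeas : Measurable ((ResponseBound Y M (8 / t) n).indicator (fun ω =>
        ENNReal.ofReal (Real.exp (err n i ω)))) :=
      Measurable.indicator (by simp only [herr]; fun_prop) hAm
    have h1 := mul_meas_ge_le_lintegral (μ := μ) hmeas (ENNReal.ofReal ((n : ℝ) ^ a))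
    have h2 : Bad n i ⊆ {ω | ENNReal.ofReal ((n : ℝ) ^ a) ≤
        (ResponseBound Y M (8 / t) n).indicator (fun ω =>
        ENNReal.ofReal (Real.exp (err n i ω))) ω} := by
      rintro ω ⟨hω1, hω2⟩
      rw [Set.mem_ofPred_eq, Set.indicator_of_mem hω1]
      refine ENNReal.ofReal_le_ofReal ?_
      have h4 : (n : ℝ) ^ a = Real.exp (a * Real.log n) := by
        rw [Real.exp_nat_mul, Real.exp_log hn0]
      rw [h4]
      exact Real.exp_le_exp.2 hω2.le
    have h3 := hN n (by omega) _ (gridPoint_mem hbc hi)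
    have h4 : ENNReal.ofReal ((n : ℝ) ^ a) * μ (Bad n i) ≤ ENNReal.ofReal (B * (n : ℝ) ^ D) :=
      ((mul_le_mul_right (measure_mono h2) _).trans h1).trans h3
    rw [ENNReal.ofReal_div_of_pos hna,
      ENNReal.le_div_iff_mul_le (Or.inl (ENNReal.ofReal_pos.2 hna).ne')
        (Or.inl ENNReal.ofReal_ne_top), mul_comm]
    exact h4
  set Ev : ℕ → Set Ω := fun n => if n < N + 1 then ∅ else ⋃ i ∈ Finset.range (n ^ 7), Bad n i
    with hEv
  have hEvb : ∀ n, μ (Ev n) ≤ ENNReal.ofReal (B * (1 / (n : ℝ) ^ 2)) := by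
    intro n
    rcases lt_or_ge n (N + 1) with hn | hn
    · simp [hEv, Nat.le_of_lt_succ hn]
    have hn0 : (0 : ℝ) < n := by exact_mod_cast (show 0 < n by omega)
    simp only [hEv, not_lt.2 hn, if_false]
    refine (measure_biUnion_finset_le _ _).trans ?_
    refine (Finset.sum_le_sum fun i hi => hbad n hn i (Finset.mem_range.1 hi)).trans ?_
    rw [Finset.sum_const, Finset.card_range, nsmul_eq_mul,
      ← ENNReal.ofReal_natCast, ← ENNReal.ofReal_mul (by positivity)]
    refine ENNReal.ofReal_le_ofReal (le_of_eq ?_)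
    rw [ha]
    push_cast
    field_simp
    ring
  have hsum : ∑' n, μ (Ev n) ≠ ⊤ := by
    refine ne_top_of_le_ne_top ?_ (ENNReal.tsum_le_tsum hEvb)
    have hs : Summable fun k : ℕ => B * (1 / (k : ℝ) ^ 2) :=
      (Real.summable_one_div_nat_pow.2 (by norm_num)).mul_left B
    rw [← ENNReal.ofReal_tsum_of_nonneg (fun k => by positivity) hs]
    exact ENNReal.ofReal_ne_top
  refine ⟨a, by positivity, ?_⟩
  filter_upwards [ae_eventually_notMem hsum] with ω hω
  filter_upwards [hω, eventually_ge_atTop (N + 1)] with n hn hnN hωn i hi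
  simp only [hEv, not_lt.2 hnN, if_false, Set.mem_iUnion, not_exists] at hn
  have := hn i (Finset.mem_range.2 hi)
  by_contra hlt
  exact this ⟨hωn, not_le.1 hlt⟩

/-- Almost sure uniform rate of the estimator with a constant initial function. -/
lemma ae_uniform_rate (S : IsIIDSample μ X Y g) (hA1 : AssumptionA1 K)
    (hLip : ∃ L, LipschitzWith L K)
    (H : RateConditions γ h lam φ) {b c : ℝ} (hbc : b < c) {f θ : ℝ → ℝ} {C R t : ℝ}
    (hC : 0 ≤ C) (ht : 0 < t)
    (hexp : Integrable (fun p : ℝ × ℝ => Real.exp (t * |p.2|)) (densityLaw g))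
    (hm : ∀ x ∈ Set.Ioo b c, ∀ η, 0 < η → KernelMoments (densityLaw g) K C x (f x) (θ x) η)
    (hf : ∀ x ∈ Set.Ioo b c, φ ≤ f x) (hR : 0 ≤ R) (hθ : ∀ x ∈ Set.Ioo b c, |θ x| ≤ R)
    (hθL : ∀ x ∈ Set.Ioo b c, ∀ y ∈ Set.Ioo b c, |y - x| ≤ 1 → |θ y - θ x| ≤ R * |y - x|)
    (c₀ : ℝ) :
    ∀ᵐ ω ∂μ, ∃ A, ∀ᶠ n : ℕ in atTop, ∀ x ∈ Set.Ioo b c,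
      |revesz γ h K X Y (fun _ => c₀) n x ω - θ x| ≤ A * (Real.log n / lam n) := by
  obtain ⟨Q, hQ⟩ := hA1.bounded
  obtain ⟨L, hL⟩ := hLip
  have hL' : ∀ z w, |K z - K w| ≤ (L : ℝ) * |z - w| := fun z w => by
    simpa [Real.dist_eq] using hL.dist_le_mul z w
  -- The constant depends on the envelope level `M`, which depends on the path; intersecting over
  -- all natural `M` lets the level be chosen afterwards.
  choose A hA0 hA using fun M : ℕ => ae_grid_rate S hA1 H hbc hC ht hexp hm hf hR hθ
    (show (0 : ℝ) ≤ M by positivity) c₀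
  obtain ⟨Cl, hCl, hlam⟩ := H.norm_le
  filter_upwards [ae_exists_responseBound S ht hexp, ae_all_iff.2 hA] with ω ⟨M, hM⟩ hω
  obtain ⟨CL, hCL, hrL⟩ := revesz_lipschitz_bound (X := X) (Y := Y) (c := 8 / t) (M := M)
    H hA1.nonneg hQ L.coe_nonneg hL' (by positivity) (by positivity) c₀
  refine ⟨A M + (CL + R) * (c - b) * Cl, ?_⟩
  have hcb : 0 < c - b := by linarith
  have hnear : ∀ᶠ n : ℕ in atTop, c - b ≤ n :=
    tendsto_natCast_atTop_atTop.eventually_ge_atTop (c - b)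
  filter_upwards [hω M, hrL, hlam, hnear, eventually_ge_atTop 1,
    RateConditions.eventually_one_le_log] with n h1 h2 h3 h4 hn hl x hx
  have hn0 : (0 : ℝ) < n := by positivity
  have hn1 : (1 : ℝ) ≤ n := by exact_mod_cast hn
  have hlp := H.norm_pos n hn
  obtain ⟨i, hi, hxi⟩ := exists_gridPoint_near hx (m := n ^ 7) (by positivity)
  have hgi := gridPoint_mem hbc hi
  set y := gridPoint b c (n ^ 7) i
  have hy := h1 (hM n) i hi
  push_cast at hxi
  have hn7 : (c - b) / (n : ℝ) ^ 7 ≤ 1 := by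
    rw [div_le_one (by positivity)]
    exact h4.trans (le_self_pow₀ hn1 (by norm_num))
  have h5 := h2 x y ω (hM n)
  have h6 := hθL y hgi x hx (hxi.trans hn7)
  have h7 : |revesz γ h K X Y (fun _ => c₀) n y ω - θ y| ≤ A M * (Real.log n / lam n) := by
    rw [← mul_div_assoc, le_div_iff₀ hlp]
    linarith
  have hlogn : Real.log n ≤ n := (Real.log_le_sub_one_of_pos hn0).trans (by linarith)
  -- Lipschitz constant `n⁴` times mesh `n⁻⁷` gives `n⁻³`, which is within `O(ln n / lam n)` because
  -- `lam n` is `O(n² ln n)`.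
  have h8 : (CL + R) * n ^ 4 * |x - y| ≤ (CL + R) * (c - b) * Cl * (Real.log n / lam n) := by
    have h9 : lam n ≤ Cl * n ^ 3 * Real.log n := by
      refine h3.trans ?_
      have : (n : ℝ) ^ 2 ≤ (n : ℝ) ^ 3 := pow_le_pow_right₀ hn1 (by norm_num)
      gcongr
    have h10 : 1 / (n : ℝ) ^ 3 ≤ Cl * (Real.log n / lam n) := by
      rw [← mul_div_assoc, div_le_div_iff₀ (by positivity) hlp]
      linarith
    calc (CL + R) * n ^ 4 * |x - y| ≤ (CL + R) * n ^ 4 * ((c - b) / n ^ 7) := by gcongr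
      _ = (CL + R) * (c - b) * (1 / (n : ℝ) ^ 3) := by field_simp
      _ ≤ (CL + R) * (c - b) * (Cl * (Real.log n / lam n)) := by gcongr
      _ = _ := by ring
  have h11 : R * |x - y| ≤ R * n ^ 4 * |x - y| :=
    mul_le_mul_of_nonneg_right (le_mul_of_one_le_right hR (one_le_pow₀ hn1)) (abs_nonneg _)
  have e : revesz γ h K X Y (fun _ => c₀) n x ω - θ x
      = (revesz γ h K X Y (fun _ => c₀) n x ω - revesz γ h K X Y (fun _ => c₀) n y ω)
        + (revesz γ h K X Y (fun _ => c₀) n y ω - θ y) - (θ x - θ y) := by ring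
  rw [e]
  refine (abs_sub _ _).trans ((add_le_add_left (abs_add_le _ _) _).trans ?_)
  linarith

end Rate

/-! ### Arbitrary bounded initial function and the two regimes -/

section Final

variable {Ω : Type*} [MeasurableSpace Ω] {μ : Measure Ω} [IsProbabilityMeasure μ]
  {X Y : ℕ → Ω → ℝ} {g : ℝ → ℝ → ℝ} {γ h lam : ℕ → ℝ} {K : ℝ → ℝ} {α a φ : ℝ}

/-- The kernel statistics of the sample law around the points of `I`. -/
lemma exists_kernelMoments (hg : Measurable (fun p : ℝ × ℝ => g p.1 p.2))
    (hg0 : ∀ s t, 0 ≤ g s t) (hK : AssumptionA1 K) {I : Set ℝ} (hne : I.Nonempty)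
    (hA3 : ∀ x ∈ I, AssumptionA3 g x) (hφ : 0 < φ) (hf : ∀ x ∈ I, φ ≤ marginalDensity g x) :
    ∃ C R, 0 ≤ C ∧ 0 ≤ R ∧
      (∀ x ∈ I, ∀ η, 0 < η → KernelMoments (densityLaw g) K C x (marginalDensity g x)
        (regressionFunction g x) η) ∧
      (∀ x ∈ I, |regressionFunction g x| ≤ R) ∧
      ∀ x ∈ I, ∀ y ∈ I, |y - x| ≤ 1 →
        |regressionFunction g y - regressionFunction g x| ≤ R * |y - x| := by
  obtain ⟨C, hC, h1, h2, h3⟩ := kernel_moment_bounds hg hg0 hK hne hA3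
  obtain ⟨R, hR, h4, h5⟩ := regressionFunction_bounds hφ hC hf h2 h3
  refine ⟨C, R, hC, hR, fun x hx η hη => ?_, h4, h5⟩
  obtain ⟨h6, h7⟩ := h1 x hx η hη
  have hfx := hφ.trans_le (hf x hx)
  have e0 : momentFun g 0 x = marginalDensity g x := by simp [momentFun, marginalDensity]
  have e1 : momentFun g 1 x = regressionFunction g x * marginalDensity g x := by
    rw [regressionFunction, div_mul_cancel₀ _ hfx.ne']
    simp [momentFun]
  refine ⟨fun q hq => (h6 q hq).1, fun q hq => (h6 q hq).2, ?_, ?_⟩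
  · simpa [e0] using h7 0 (by norm_num)
  · simpa [e1] using h7 1 le_rfl

/-- Almost sure uniform rate of the estimator with a bounded initial function. -/
lemma ae_supBigO (S : IsIIDSample μ X Y g) (hA1 : AssumptionA1 K)
    (hLip : ∃ L, LipschitzWith L K) (H : RateConditions γ h lam φ) {b c : ℝ} (hbc : b < c)
    (hA3 : ∀ x ∈ Set.Ioo b c, AssumptionA3 g x) (hφ : 0 < φ)
    (hf : ∀ x ∈ Set.Ioo b c, φ ≤ marginalDensity g x)
    (hexp : ∃ t : ℝ, 0 < t ∧ Integrable (fun ω => Real.exp (t * |Y 0 ω|)) μ)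
    {r₀ : ℝ → ℝ} (hr₀ : ∃ C, ∀ x ∈ Set.Ioo b c, |r₀ x| ≤ C) {v : ℕ → ℝ}
    (hv : ∀ᶠ n : ℕ in atTop, Real.log n / lam n = v n) :
    ∀ᵐ ω ∂μ, SupBigO (Set.Ioo b c)
      (fun n x => revesz γ h K X Y r₀ n x ω - regressionFunction g x) v := by
  obtain ⟨C, R, hC, hR, hm, hθ, hθL⟩ := exists_kernelMoments S.measurable_g S.nonneg_g hA1
    (Set.nonempty_Ioo.2 hbc) hA3 hφ hf
  obtain ⟨t, ht, hexp⟩ := hexp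
  have hexp' : Integrable (fun p : ℝ × ℝ => Real.exp (t * |p.2|)) (densityLaw g) := by
    rw [densityLaw, ← S.law 0, integrable_map_measure
      (Measurable.aestronglyMeasurable (by fun_prop)) (S.measurable_pair 0).aemeasurable]
    exact hexp
  obtain ⟨Q, hQ⟩ := hA1.bounded
  have hrate := fun c₀ : ℝ =>
    ae_uniform_rate S hA1 hLip H hbc hC ht hexp' hm hf hR hθ hθL c₀
  obtain ⟨R₀, hR₀⟩ := hr₀
  have hne : (Set.Ioo b c).Nonempty := Set.nonempty_Ioo.2 hbc
  filter_upwards [hrate 0, hrate 1] with ω ⟨A₀, h0⟩ ⟨A₁, h1⟩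
  constructor
  · intro n
    -- For finiteness at a fixed `n`, any path lies below a constant envelope, namely the sum of its
    -- first absolute responses.
    obtain ⟨B, -, hB⟩ := revesz_bound_finite (γ := γ) (h := h) (X := X) (Y := Y) hA1.nonneg hQ
      (∑ k ∈ Finset.range (n + 1), |Y k ω|) 0 r₀ ⟨R₀, hR₀⟩ n
    refine ⟨B + R, ?_⟩
    rintro _ ⟨x, hx, rfl⟩
    refine (abs_sub _ _).trans (add_le_add (hB x hx ω fun k _ hk => ?_) (hθ x hx))
    rw [zero_mul, add_zero]
    exact Finset.single_le_sum (f := fun k => |Y k ω|) (fun k _ => abs_nonneg _)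
      (Finset.mem_range.2 (by omega))
  · refine IsBigO.of_bound (A₀ + (A₁ + A₀) * R₀) ?_
    filter_upwards [h0, h1, hv, eventually_ge_atTop 1] with n h0 h1 hv hn
    have hv0 : 0 ≤ v n := by
      rw [← hv]
      exact div_nonneg (Real.log_natCast_nonneg n) (H.norm_pos n hn).le
    have hs0 : 0 ≤ sSup ((fun x => |revesz γ h K X Y r₀ n x ω - regressionFunction g x|) ''
        Set.Ioo b c) := by
      refine Real.sSup_nonneg ?_
      rintro _ ⟨x, -, rfl⟩
      exact abs_nonneg _
    rw [Real.norm_of_nonneg hs0, Real.norm_of_nonneg hv0]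
    refine csSup_le (hne.image _) ?_
    rintro _ ⟨x, hx, rfl⟩
    have h2 := h0 x hx
    have h3 := h1 x hx
    rw [hv] at h2 h3
    simp only
    rw [revesz_affine]
    set u := revesz γ h K X Y (fun _ => 0) n x ω
    set w := revesz γ h K X Y (fun _ => 1) n x ω
    set θ := regressionFunction g x
    -- The errors started from `0` and `1` combine with weights `1 - r₀(x)` and `r₀(x)`, bounded on
    -- the interval.
    have e : u + (w - u) * r₀ x - θ = (u - θ) + ((w - θ) - (u - θ)) * r₀ x := by ring
    rw [e]
    have h4 : |((w - θ) - (u - θ)) * r₀ x| ≤ (A₁ * v n + A₀ * v n) * R₀ := by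
      rw [abs_mul]
      have h5 := (abs_sub (w - θ) (u - θ)).trans (add_le_add h3 h2)
      exact mul_le_mul h5 (hR₀ x hx) (abs_nonneg _) ((abs_nonneg _).trans h5)
    refine (abs_add_le _ _).trans ((add_le_add h2 h4).trans (le_of_eq ?_))
    ring

/-- The rate conditions that depend only on the stepsizes and bandwidths. -/
lemma rateConditions_of_GS (hα : α ∈ Set.Ioc (3 / 4 : ℝ) 1) (hγ : GS γ (-α)) (hh : GS h (-a))
    (ha0 : 0 < a) (haα : a < α) {ℓ l₀ : ℝ} (hlam : GS lam ℓ) (hℓ : 0 ≤ ℓ) (hφ : 0 < φ)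
    (hl₀ : ℓ / φ < l₀) (hL : ∀ᶠ n : ℕ in atTop, l₀ < n * γ n)
    (hbias : ∃ C : ℝ, 0 < C ∧ ∀ᶠ n : ℕ in atTop, lam n * h n ^ 2 ≤ C * Real.log n)
    (hvar : ∃ C : ℝ, 0 < C ∧ ∀ᶠ n : ℕ in atTop, lam n ^ 2 * (γ n * (h n)⁻¹) ≤ C) :
    RateConditions γ h lam φ := by
  have hγ0 : Tendsto γ atTop (𝓝 0) := hγ.tendsto_zero (by linarith [hα.1])
  refine ⟨hγ.1, hh.1, hlam.1, hγ0, hh.tendsto_zero (by linarith), ?_, ?_, hbias, hvar,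
    eventually_contraction hlam hℓ hφ hγ.1 hγ0 hl₀ hL⟩
  -- The index is `(a - α)/2 < 0`, which the logarithm, of index `0`, does not change.
  · have h1 := ((hγ.mul hh.inv).sqrt.mul GS.log_nat).tendsto_zero (by linarith)
    refine h1.congr' ?_
    filter_upwards [eventually_ge_atTop 2] with n hn
    rw [if_neg (by omega)]
  · obtain ⟨C, hC, h1⟩ := hh.inv.le_rpow (show -(-a) < 1 by linarith [hα.2])
    exact ⟨C, hC, fun n hn => by simpa using h1 n hn⟩

end Final

end

theorem theorem3 {Ω : Type*} [MeasurableSpace Ω] (μ : Measure Ω) [IsProbabilityMeasure μ]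
    (X Y : ℕ → Ω → ℝ) (g : ℝ → ℝ → ℝ) (hXY : IsIIDSample μ X Y g)
    (K : ℝ → ℝ) (γ h : ℕ → ℝ) (α a : ℝ) (r₀ : ℝ → ℝ)
    (b c : ℝ) (hbc : b < c) (φ : ℝ)
    (hφ : φ = sInf (marginalDensity g '' Set.Ioo b c)) (hφ_pos : 0 < φ)
    (hr₀ : ∃ C, ∀ x ∈ Set.Ioo b c, |r₀ x| ≤ C)
    (hA1 : AssumptionA1 K) (hA2 : AssumptionA2 γ h α a)
    (hA3 : ∀ x ∈ Set.Ioo b c, AssumptionA3 g x)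
    (hA4 : AssumptionA4 μ (Y 0) K g α a) :
    ((∃ C, ∀ n : ℕ, 2 ≤ n → (γ n)⁻¹ * h n ^ 5 / Real.log n ^ 2 ≤ C) →
      LimStepGT γ ((1 - a) / (2 * φ)) →
      ∀ᵐ ω ∂μ, SupBigO (Set.Ioo b c)
        (fun n x => revesz γ h K X Y r₀ n x ω - regressionFunction g x)
        (fun n => Real.sqrt (γ n * (h n)⁻¹) * Real.log n)) ∧
    (Tendsto (fun n : ℕ => (γ n)⁻¹ * h n ^ 5 / Real.log n ^ 2) atTop atTop →
      LimStepGT γ (2 * a / φ) →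
      ∀ᵐ ω ∂μ, SupBigO (Set.Ioo b c)
        (fun n x => revesz γ h K X Y r₀ n x ω - regressionFunction g x)
        (fun n => h n ^ 2)) := by
  have hf : ∀ x ∈ Set.Ioo b c, φ ≤ marginalDensity g x := by
    intro x hx
    rw [hφ]
    refine csInf_le ⟨0, ?_⟩ ⟨x, hx, rfl⟩
    rintro _ ⟨y, -, rfl⟩
    exact integral_nonneg fun t => hXY.nonneg_g y t
  have hα := hA2.alpha_mem
  have hγ := hA2.stepsize
  have hh := hA2.bandwidth
  have ha0 : 0 < a := by linarith [hA2.a_mem.1, hα.2]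
  have haα : a < α := by linarith [hA2.a_mem.2, hα.1]
  have hratio := hγ.mul hh.inv
  constructor
  · rintro ⟨C, hC⟩ hlim
    obtain ⟨l₀, hl₀, hL⟩ := hlim.exists_between
    -- Here `lam = (γ/h)^(-1/2)`, of index `(α - a)/2 ≤ (1 - a)/2`. The noise condition is an
    -- equality, and the bias condition is the square root of the boundedness hypothesis.
    have hlam := hratio.sqrt.inv
    have hpos : ∀ n : ℕ, 2 ≤ n → 0 < Real.sqrt (γ n * (h n)⁻¹) := fun n hn =>
      hratio.sqrt.1 n (by omega)
    refine ae_supBigO hXY hA1 hA4.lipschitz (rateConditions_of_GS hα hγ hh ha0 haα hlam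
      (by linarith) hφ_pos (lt_of_le_of_lt ?_ hl₀) hL ⟨Real.sqrt (|C| + 1), by positivity, ?_⟩
      ⟨1, one_pos, ?_⟩) hbc hA3 hφ_pos hf hA4.exp_moment hr₀ ?_
    · rw [div_le_div_iff₀ hφ_pos (by positivity)]
      have := mul_le_mul_of_nonneg_right (show α - a ≤ 1 - a by linarith [hα.2]) hφ_pos.le
      linarith
    · filter_upwards [eventually_ge_atTop 2] with n hn
      have hlog : 0 < Real.log n := Real.log_pos (by exact_mod_cast hn)
      have hγn := hγ.1 n (by omega)
      have hhn := hh.1 n (by omega)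
      have h1 := hC n hn
      rw [div_le_iff₀ (by positivity), inv_mul_le_iff₀ hγn] at h1
      rw [inv_mul_le_iff₀ (hpos n hn)]
      refine abs_le_of_sq_le_sq' ?_ (by positivity) |>.2
      rw [mul_pow, mul_pow, Real.sq_sqrt (by positivity), Real.sq_sqrt (by positivity)]
      have h2 : γ n * (C * Real.log n ^ 2) ≤ γ n * ((|C| + 1) * Real.log n ^ 2) := by
        have := le_abs_self C
        gcongr
        linarith
      calc (h n ^ 2) ^ 2 = (h n)⁻¹ * h n ^ 5 := by field_simp
        _ ≤ (h n)⁻¹ * (γ n * ((|C| + 1) * Real.log n ^ 2)) := by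
          gcongr
          linarith
        _ = _ := by ring
    · filter_upwards [eventually_ge_atTop 2] with n hn
      have h1 := hpos n hn
      have h2 : 0 < γ n * (h n)⁻¹ := Real.sqrt_pos.1 h1
      rw [inv_pow, Real.sq_sqrt h2.le, inv_mul_cancel₀ h2.ne']
    · refine Eventually.of_forall fun n => ?_
      rw [div_inv_eq_mul, mul_comm]
  · intro hinf hlim
    obtain ⟨l₀, hl₀, hL⟩ := hlim.exists_between
    -- Here `lam = ln n / h²`, of index `2a`. The bias condition is an equality, and the noise
    -- condition reads `γ (ln n)² / h⁵ ≤ 1`, true eventually since the inverse diverges.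
    have hlam := GS.log_nat.mul (hh.mul hh).inv
    refine ae_supBigO hXY hA1 hA4.lipschitz (rateConditions_of_GS hα hγ hh ha0 haα hlam
      (by linarith) hφ_pos (lt_of_eq_of_lt ?_ hl₀) hL ⟨1, one_pos, ?_⟩
      ⟨1, one_pos, ?_⟩) hbc hA3 hφ_pos hf hA4.exp_moment hr₀ ?_
    · ring
    · filter_upwards [eventually_ge_atTop 2] with n hn
      have hhn := hh.1 n (by omega)
      rw [if_neg (by omega)]
      refine le_of_eq ?_
      field_simp
    · filter_upwards [hinf.eventually_ge_atTop 1, eventually_ge_atTop 2] with n h1 hn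
      have hlog : 0 < Real.log n := Real.log_pos (by exact_mod_cast hn)
      have hγn := hγ.1 n (by omega)
      have hhn := hh.1 n (by omega)
      rw [le_div_iff₀ (by positivity), one_mul, le_inv_mul_iff₀ hγn] at h1
      rw [if_neg (by omega)]
      have e : (Real.log n * (h n * h n)⁻¹) ^ 2 * (γ n * (h n)⁻¹)
          = γ n * Real.log n ^ 2 / h n ^ 5 := by
        field_simp
      rw [e, div_le_one (by positivity)]
      exact h1
    · filter_upwards [eventually_ge_atTop 2] with n hn
      have hlog : 0 < Real.log n := Real.log_pos (by exact_mod_cast hn)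
      have hhn := hh.1 n (by omega)
      rw [if_neg (by omega)]
      field_simp
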